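/- For a random variable $X$ with values in a discrete set, with probability mass function $f(x)=\mathbb P(X=x)$, let $\mathrm{Varent}(X)=\mathrm{Var}(\log f(X))\in[0,\infty]$. Let $\mathcal V(0)=0$ and $\mathcal V(t)=t\log^2\!\big(1+\tfrac1{\sqrt t}\big)$ for $t>0$. For a finitely supported nonnegative measure $\mu$ on a discrete group $G$, the random walk with jump measure $\mu$ is the continuous-time Markov chain $(X_t)_{t\ge0}$ on $G$ that starts at the identity and whose generator acts on bounded functions $f:G\to\mathbb R$ by $(Lf)(x)=\sum_{z\in G}\mu(z)\,(f(xz)-f(x))$. **Theorem.** (i) There is a universal constant $c<\infty$ such that the following holds. Let $\mu$ be a finitely supported nonnegative measure on a discrete group $G$ that is conjugacy-invariant ($\mu(xzx^{-1})=\mu(z)$ for all $x,z\in G$) and symmetric ($\mu(z^{-1})=\mu(z)$ for all $z\in G$), and suppose that, away from the identity, $\mu=\sum_{i=1}^d\mu_i(\delta_{e_i}+\delta_{e_i^{-1}})$ with $d\ge0$, rates $\mu_1,\dots,\mu_d>0$ and elements $e_1,\dots,e_d\in G\setminus\{1\}$ (every symmetric finitely supported $\mu$ can be written in this way). Then the random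 walk $(X_t)_{t\ge0}$ with jump measure $\mu$ satisfies, for all $t\ge0$, $$\mathrm{Varent}(X_t)\;\le\;c\sum_{i=1}^d\mathcal V(\mu_i t).$$ (ii) This is sharp: there is a universal constant $c'>0$ such that, for all $d$ and all rates $\mu_1,\dots,\mu_d>0$, if $(X_t)_{t\ge0}$ is the random walk on $\mathbb Z^d$ started at $0$ that jumps by $+u_i$ and by $-u_i$, each at rate $\mu_i$, independently for $1\le i\le d$ ($u_i$ being the $i$-th unit vector), then for all $t\ge0$ $$\mathrm{Varent}(X_t)\;\ge\;c'\sum_{i=1}^d\mathcal V(\mu_i t).$$ -/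

import Mathlib

open MeasureTheory ProbabilityTheory
open scoped NNReal ENNReal BoundedContinuousFunction

noncomputable section

/-- The generator `(L f)(x) = ∑ z, μ z * (f (x * z) - f x)` of the continuous-time random walk on the
discrete group `G` with jump measure `μ`, as a bounded operator on the bounded functions on `G`
(since `G` is discrete, every function on `G` is continuous). -/
def walkGenerator {G : Type*} [Group G] [TopologicalSpace G] [DiscreteTopology G]
    (μ : G →₀ ℝ≥0) : (G →ᵇ ℝ) →L[ℝ] (G →ᵇ ℝ) :=
  ∑ z ∈ μ.support, (μ z : ℝ) •
    (BoundedContinuousFunction.compContinuousCLM ℝ ℝ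
        (⟨fun x : G => x * z, continuous_of_discreteTopology⟩ : C(G, G)) -
      ContinuousLinearMap.id ℝ (G →ᵇ ℝ))

theorem walkGenerator_apply {G : Type*} [Group G] [TopologicalSpace G] [DiscreteTopology G]
    (μ : G →₀ ℝ≥0) (f : G →ᵇ ℝ) (x : G) :
    walkGenerator μ f x = ∑ z ∈ μ.support, (μ z : ℝ) * (f (x * z) - f x) := by
  simp [walkGenerator]

/-- The exponential `exp (t A) = ∑ n, (t A) ^ n / n!` of a bounded operator `A` on a normed space. -/
def operatorSemigroup {E : Type*} [NormedAddCommGroup E] [NormedSpace ℝ E]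
    (A : E →L[ℝ] E) (t : ℝ≥0) : E →L[ℝ] E :=
  NormedSpace.exp ((t : ℝ) • A)

/-- The Markov semigroup `P_t = exp (t L)` generated by `L = walkGenerator μ`. -/
def walkSemigroup {G : Type*} [Group G] [TopologicalSpace G] [DiscreteTopology G]
    (μ : G →₀ ℝ≥0) (t : ℝ≥0) : (G →ᵇ ℝ) →L[ℝ] (G →ᵇ ℝ) :=
  operatorSemigroup (walkGenerator μ) t

/-- The σ-algebra `σ(X r : r ≤ s)` of the past of the process `X` up to time `s`; the state space
carries the σ-algebra of all its subsets. -/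
abbrev pastUpTo {G Ω : Type*} (X : ℝ≥0 → Ω → G) (s : ℝ≥0) : MeasurableSpace Ω :=
  ⨆ r : Set.Iic s, MeasurableSpace.comap (X r) ⊤

/-- `X` is, under the probability measure `P`, a continuous-time Markov chain on the discrete group
`G` which starts at the identity and has generator `walkGenerator μ`. -/
structure IsRandomWalk {G : Type*} [Group G] [TopologicalSpace G] [DiscreteTopology G]
    (μ : G →₀ ℝ≥0) {Ω : Type*} [MeasurableSpace Ω] (P : Measure Ω) (X : ℝ≥0 → Ω → G) : Prop where
  measurable : ∀ t, Measurable[_, ⊤] (X t)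
  start : ∀ᵐ ω ∂P, X 0 ω = 1
  markov : ∀ (s h : ℝ≥0) (f : G →ᵇ ℝ),
    P[fun ω => f (X (s + h) ω) | pastUpTo X s] =ᵐ[P] fun ω => walkSemigroup μ h f (X s ω)

/-- The varentropy `Var (log f(X))` of a discrete random variable `X`, where `f x = P (X = x)`. The
variance is taken in `[0, ∞]`: it is `∞` when `log f(X)` is not square-integrable. -/
def varent {G Ω : Type*} [MeasurableSpace Ω] (P : Measure Ω) (X : Ω → G) : ℝ≥0∞ :=
  evariance (fun ω => Real.log (P.real (X ⁻¹' {X ω}))) P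

/-- The function `V(t) = t log² (1 + 1 / √t)`, with `V(0) = 0`. -/
def varentBound (t : ℝ) : ℝ := t * Real.log (1 + 1 / √t) ^ 2

/-- The measure `∑ i, rate i • (δ_{e i} + δ_{(e i)⁻¹})`. -/
def generatorMeasure {G : Type*} [Group G] {d : ℕ} (e : Fin d → G) (rate : Fin d → ℝ≥0) :
    G →₀ ℝ≥0 :=
  ∑ i, (Finsupp.single (e i) (rate i) + Finsupp.single (e i)⁻¹ (rate i))

/-- The `i`-th unit vector of `ℤ ^ d`, the latter being written multiplicatively. -/
def unitVector {d : ℕ} (i : Fin d) : Multiplicative (Fin d → ℤ) :=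
  Multiplicative.ofAdd (Pi.single i 1)

end

/-! Upper bound. Write P_t for the semigroup and p_t for the law of X_t. The map s ↦ P_s((P_{t-s}
f)²) interpolates between (P_t f)² and P_t(f²), and its derivative is P_s applied to the carré du
champ of P_{t-s} f. Conjugacy invariance makes P_t commute with right translations, so Jensen's
inequality yields the local Poincaré inequality `walkSemigroup_sq_sub_sq_le`: Var f(X_t) ≤ t ∑ μ(z)
E (f(X_t z) - f(X_t))². It is applied to f = log p_t, truncated from below;
`evariance_le_of_forall_truncation` removes the truncation.

For a jump e of rate r put s = rt and split off a Poisson(s) number N of e-jumps. Shifting N by one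
gives p_t(xe) / p_t(x) ≥ E[s/(N+1) | X_t = x], hence p_t(x) / p_t(xe) ≤ 1 + √E[(N+1-s)² | X_t = x] /
s by Jensen and Cauchy–Schwarz (`poisson_mixture_ratio`). The conditional moments average to
E(N+1-s)² = s + 1, which bounds the mean square of the decrements of log p_t along e
(`heatKernel_mul_right_pos_and_sum_le`). By symmetry of μ the same bound for e⁻¹ controls the
increments.

Lower bound. On ℤ^d the law is a product, so the varentropy is a sum over the coordinates and d = 1
suffices. The kernel p on ℤ decreases in |k| and satisfies k p(k) = s (p(k-1) - p(k+1))
(`mul_walkKernel`), whence its moments and the ratios of its values. The variance of log p is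
bounded below by two sets of substantial mass on which p differs by a definite factor
(`mul_sq_log_div_le_variance`): {0} and {1} for small s, {0} and {2} for intermediate s, centre and
tail at scale √s for large s. -/

noncomputable section

set_option linter.unusedSectionVars false

/-! ### Exponentials of bounded operators. -/

section Semigroup

variable {E : Type*} [NormedAddCommGroup E] [NormedSpace ℝ E] [CompleteSpace E]

theorem hasSum_operatorSemigroup_apply (A : E →L[ℝ] E) (t : ℝ≥0) (f : E) :
    HasSum (fun n : ℕ => ((n.factorial : ℝ)⁻¹ * (t : ℝ) ^ n) • (A ^ n) f)
      (operatorSemigroup A t f) := by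
  have h := NormedSpace.exp_series_hasSum_exp' (𝕂 := ℝ) ((t : ℝ) • A)
  have h2 := (ContinuousLinearMap.apply ℝ E f).hasSum h
  simpa [smul_pow, mul_smul, operatorSemigroup] using h2

theorem operatorSemigroup_sub_smul_one (A : E →L[ℝ] E) (a : ℝ) (t : ℝ≥0) :
    operatorSemigroup (A - a • (1 : E →L[ℝ] E)) t = Real.exp (-(a * t)) • operatorSemigroup A t := by
  let _ : NormedAlgebra ℚ (E →L[ℝ] E) := NormedAlgebra.restrictScalars ℚ ℝ _
  rw [operatorSemigroup, smul_sub, smul_smul, sub_eq_add_neg, ← neg_smul,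
    NormedSpace.exp_add_of_commute]
  · rw [← Algebra.algebraMap_eq_smul_one, ← NormedSpace.algebraMap_exp_comm,
      Algebra.algebraMap_eq_smul_one, ← Real.exp_eq_exp_ℝ, mul_comm (t : ℝ)]
    simp [operatorSemigroup]
  · rw [← Algebra.algebraMap_eq_smul_one]
    exact (Algebra.commutes _ _).symm

theorem operatorSemigroup_add_apply {A B : E →L[ℝ] E} (h : ∀ f, A (B f) = B (A f)) (t : ℝ≥0)
    (f : E) : operatorSemigroup (A + B) t f = operatorSemigroup A t (operatorSemigroup B t f) := by
  let _ : NormedAlgebra ℚ (E →L[ℝ] E) := NormedAlgebra.restrictScalars ℚ ℝ _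
  have hc : Commute A B := by ext f; exact h f
  rw [operatorSemigroup, smul_add,
    NormedSpace.exp_add_of_commute ((hc.smul_left _).smul_right _)]
  rfl

theorem operatorSemigroup_commute {A B : E →L[ℝ] E} (h : ∀ f, A (B f) = B (A f)) (t : ℝ≥0)
    (f : E) : operatorSemigroup A t (B f) = B (operatorSemigroup A t f) := by
  have hc : Commute A B := by ext f; exact h f
  exact DFunLike.congr_fun ((hc.smul_left (t : ℝ)).exp_left).eq f

theorem operatorSemigroup_apply_of_apply_eq_zero {A : E →L[ℝ] E} {f : E} (h : A f = 0) (t : ℝ≥0) :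
    operatorSemigroup A t f = f := by
  refine (hasSum_operatorSemigroup_apply A t f).unique ?_
  convert hasSum_single (f := fun n : ℕ => ((n.factorial : ℝ)⁻¹ * (t : ℝ) ^ n) • (A ^ n) f) 0 ?_
    using 1
  · simp
  · intro n hn
    obtain ⟨m, rfl⟩ := Nat.exists_eq_succ_of_ne_zero hn
    simp [pow_succ, h]

theorem operatorSemigroup_smul (A : E →L[ℝ] E) (r t : ℝ≥0) :
    operatorSemigroup ((r : ℝ) • A) t = operatorSemigroup A (r * t) := by
  rw [operatorSemigroup, operatorSemigroup, smul_smul]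
  push_cast
  rw [mul_comm (t : ℝ)]

end Semigroup

/-! ### Translations, positivity and commutation of the walk semigroup. -/

section Operators

variable {G : Type*} [Group G] [TopologicalSpace G] [DiscreteTopology G]

/-- The right translation `(T_z f)(x) = f (x * z)`. -/
def translation (z : G) : (G →ᵇ ℝ) →L[ℝ] (G →ᵇ ℝ) :=
  BoundedContinuousFunction.compContinuousCLM ℝ ℝ
    (⟨fun x : G => x * z, continuous_of_discreteTopology⟩ : C(G, G))

@[simp] theorem translation_apply (z : G) (f : G →ᵇ ℝ) (x : G) :
    translation z f x = f (x * z) := rfl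

theorem translation_one : translation (1 : G) = 1 := by
  ext f x; simp

theorem translation_mul (z w : G) : translation (z * w) = translation z * translation w := by
  ext f x; simp [mul_assoc]

theorem translation_pow (z : G) (n : ℕ) : translation (z ^ n) = translation z ^ n := by
  induction n with
  | zero => simp [translation_one]
  | succ n ih => rw [pow_succ, pow_succ, translation_mul, ih]

theorem walkGenerator_eq_sum (μ : G →₀ ℝ≥0) :
    walkGenerator μ = μ.sum fun z r => (r : ℝ) • (translation z - 1) := rfl

theorem walkGenerator_add (μ ν : G →₀ ℝ≥0) :
    walkGenerator (μ + ν) = walkGenerator μ + walkGenerator ν := by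
  simp only [walkGenerator_eq_sum]
  refine Finsupp.sum_add_index' (by simp) (by intros; simp [add_smul])

theorem walkGenerator_single (z : G) (r : ℝ≥0) :
    walkGenerator (Finsupp.single z r) = (r : ℝ) • (translation z - 1) := by
  simp [walkGenerator_eq_sum]

theorem walkGenerator_zero : walkGenerator (0 : G →₀ ℝ≥0) = 0 := by
  simp [walkGenerator_eq_sum]

/-- An operator on bounded functions which preserves nonnegativity. -/
def IsPositiveOp (A : (G →ᵇ ℝ) →L[ℝ] (G →ᵇ ℝ)) : Prop :=
  ∀ f : G →ᵇ ℝ, (∀ x, 0 ≤ f x) → ∀ x, 0 ≤ A f x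

theorem IsPositiveOp.pow {A : (G →ᵇ ℝ) →L[ℝ] (G →ᵇ ℝ)} (hA : IsPositiveOp A) (n : ℕ) :
    IsPositiveOp (A ^ n) := by
  induction n with
  | zero => intro f hf x; simpa using hf x
  | succ n ih => intro f hf x; rw [pow_succ]; exact ih _ (hA f hf) x

theorem hasSum_operatorSemigroup_apply_apply (A : (G →ᵇ ℝ) →L[ℝ] (G →ᵇ ℝ)) (t : ℝ≥0) (f : G →ᵇ ℝ)
    (x : G) : HasSum (fun n : ℕ => (n.factorial : ℝ)⁻¹ * (t : ℝ) ^ n * (A ^ n) f x)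
      (operatorSemigroup A t f x) :=
  (BoundedContinuousFunction.evalCLM ℝ x).hasSum (hasSum_operatorSemigroup_apply A t f)

theorem IsPositiveOp.operatorSemigroup {A : (G →ᵇ ℝ) →L[ℝ] (G →ᵇ ℝ)} (hA : IsPositiveOp A)
    (t : ℝ≥0) : IsPositiveOp (operatorSemigroup A t) := fun f hf x =>
  (hasSum_operatorSemigroup_apply_apply A t f x).nonneg fun n =>
    mul_nonneg (by positivity) (hA.pow n f hf x)

theorem isPositiveOp_translation_sum (μ : G →₀ ℝ≥0) :
    IsPositiveOp (μ.sum fun z r => (r : ℝ) • translation z) := by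
  intro f hf x
  simp only [Finsupp.sum, sum_apply, BoundedContinuousFunction.sum_apply]
  exact Finset.sum_nonneg fun z _ => mul_nonneg (μ z).2 (hf _)

/-- The generator is a positive operator minus a multiple of the identity; the latter only
contributes a positive scalar factor to the exponential. -/
theorem isPositiveOp_walkSemigroup (μ : G →₀ ℝ≥0) (t : ℝ≥0) : IsPositiveOp (walkSemigroup μ t) := by
  have h : walkGenerator μ = (μ.sum fun z r => (r : ℝ) • translation z) -
      (μ.sum fun _ r => (r : ℝ)) • (1 : (G →ᵇ ℝ) →L[ℝ] (G →ᵇ ℝ)) := by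
    ext f x
    simp [walkGenerator_apply, Finsupp.sum, mul_sub, Finset.sum_mul]
  intro f hf x
  rw [walkSemigroup, h, operatorSemigroup_sub_smul_one]
  exact mul_nonneg (Real.exp_pos _).le ((isPositiveOp_translation_sum μ).operatorSemigroup t f hf x)

theorem walkSemigroup_apply_of_invariant (μ : G →₀ ℝ≥0) (t : ℝ≥0) {f : G →ᵇ ℝ}
    (hf : ∀ z ∈ μ.support, ∀ x, f (x * z) = f x) : walkSemigroup μ t f = f := by
  refine operatorSemigroup_apply_of_apply_eq_zero ?_ t
  ext x
  rw [walkGenerator_apply]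
  refine Finset.sum_eq_zero ?_
  intro z hz
  rw [hf z hz, sub_self, mul_zero]

theorem walkSemigroup_const (μ : G →₀ ℝ≥0) (t : ℝ≥0) (c : ℝ) :
    walkSemigroup μ t (BoundedContinuousFunction.const G c) =
      BoundedContinuousFunction.const G c :=
  walkSemigroup_apply_of_invariant μ t (f := BoundedContinuousFunction.const G c) fun _ _ _ => rfl

theorem IsPositiveOp.mono {A : (G →ᵇ ℝ) →L[ℝ] (G →ᵇ ℝ)} (hA : IsPositiveOp A) {f g : G →ᵇ ℝ}
    (h : ∀ x, f x ≤ g x) (x : G) : A f x ≤ A g x := by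
  have := hA (g - f) (fun x => by simpa using h x) x
  simpa using this

/-- Jensen's inequality, from P_t((f - c)²) ≥ 0 with c = P_t f(x). -/
theorem sq_walkSemigroup_le (μ : G →₀ ℝ≥0) (t : ℝ≥0) (f : G →ᵇ ℝ) (x : G) :
    (walkSemigroup μ t f x) ^ 2 ≤ walkSemigroup μ t (f * f) x := by
  set c := walkSemigroup μ t f x with hc
  have h := isPositiveOp_walkSemigroup μ t
    (f * f - (2 * c) • f + BoundedContinuousFunction.const G (c ^ 2))
    (fun y => by simp; nlinarith [sq_nonneg (f y - c)]) x
  rw [map_add, map_sub, map_smul, walkSemigroup_const] at h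
  simp only [BoundedContinuousFunction.add_apply, BoundedContinuousFunction.sub_apply,
    BoundedContinuousFunction.smul_apply, BoundedContinuousFunction.const_apply, ← hc,
    smul_eq_mul] at h
  nlinarith

/-- Conjugacy invariance enters here: reindexing by z ↦ w⁻¹zw exchanges xzw and xwz. -/
theorem walkGenerator_translation {μ : G →₀ ℝ≥0}
    (hμ : ∀ x z : G, μ (x * z * x⁻¹) = μ z) (w : G) (f : G →ᵇ ℝ) :
    walkGenerator μ (translation w f) = translation w (walkGenerator μ f) := by
  have hμ' (z : G) : μ (w⁻¹ * z * w) = μ z := by simpa using hμ w⁻¹ z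
  ext x
  simp only [walkGenerator_apply, translation_apply]
  refine Finset.sum_nbij' (fun z => w⁻¹ * z * w) (fun z => w * z * w⁻¹) ?_ ?_ ?_ ?_ ?_
  · intro z hz
    simpa [hμ'] using hz
  · intro z hz
    simpa [hμ w z] using hz
  · intro z _; group
  · intro z _; group
  · intro z _
    rw [hμ', show x * w * (w⁻¹ * z * w) = x * z * w by group]

theorem walkSemigroup_translation {μ : G →₀ ℝ≥0}
    (hμ : ∀ x z : G, μ (x * z * x⁻¹) = μ z) (t : ℝ≥0) (w : G) (f : G →ᵇ ℝ) :
    walkSemigroup μ t (translation w f) = translation w (walkSemigroup μ t f) :=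
  operatorSemigroup_commute (walkGenerator_translation hμ w) t f

theorem walkSemigroup_add_apply {μ ν : G →₀ ℝ≥0}
    (h : ∀ f, walkGenerator μ (walkGenerator ν f) = walkGenerator ν (walkGenerator μ f)) (t : ℝ≥0)
    (f : G →ᵇ ℝ) : walkSemigroup (μ + ν) t f = walkSemigroup μ t (walkSemigroup ν t f) := by
  rw [walkSemigroup, walkGenerator_add]
  exact operatorSemigroup_add_apply h t f

theorem hasSum_walkSemigroup_single (z : G) (r t : ℝ≥0) (f : G →ᵇ ℝ) (x : G) :
    HasSum (fun n : ℕ => Real.exp (-(r * t)) * (r * t) ^ n / n.factorial * f (x * z ^ n))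
      (walkSemigroup (Finsupp.single z r) t f x) := by
  rw [walkSemigroup, walkGenerator_single, operatorSemigroup_smul, ← one_smul ℝ (1 : _ →L[ℝ] _),
    operatorSemigroup_sub_smul_one]
  have h := (hasSum_operatorSemigroup_apply_apply (translation z) (r * t) f x).mul_left
    (Real.exp (-(r * t)))
  simp only [← translation_pow, translation_apply] at h
  have hn (n : ℕ) : Real.exp (-(r * t)) * (r * t) ^ n / n.factorial * f (x * z ^ n) =
      Real.exp (-(r * t)) * ((n.factorial : ℝ)⁻¹ * ((r * t : ℝ≥0) : ℝ) ^ n * f (x * z ^ n)) := by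
    push_cast
    rw [div_eq_mul_inv]
    ring
  simp only [hn]
  have he : Real.exp (-(r * t)) * operatorSemigroup (translation z) (r * t) f x =
      (Real.exp (-(1 * ((r * t : ℝ≥0) : ℝ))) • operatorSemigroup (translation z) (r * t)) f x := by
    rw [one_mul]
    push_cast
    rfl
  rw [← he]
  exact h

end Operators

/-! ### Derivative of the interpolation along the semigroup. -/

section SemigroupDerivative

variable {E : Type*} [NormedAddCommGroup E] [NormedSpace ℝ E] [CompleteSpace E]

theorem operatorSemigroup_add_time (A : E →L[ℝ] E) (s t : ℝ≥0) (f : E) :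
    operatorSemigroup A (s + t) f = operatorSemigroup A s (operatorSemigroup A t f) := by
  let _ : NormedAlgebra ℚ (E →L[ℝ] E) := NormedAlgebra.restrictScalars ℚ ℝ _
  rw [operatorSemigroup, NNReal.coe_add, add_smul, NormedSpace.exp_add_of_commute
    (((Commute.refl A).smul_left _).smul_right _)]
  rfl

/-- The exponential `exp (t A)` for a real time parameter `t`. -/
def operatorGroup (A : E →L[ℝ] E) (t : ℝ) : E →L[ℝ] E :=
  NormedSpace.exp (t • A)

theorem operatorGroup_coe (A : E →L[ℝ] E) (t : ℝ≥0) : operatorGroup A t = operatorSemigroup A t :=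
  rfl

theorem operatorGroup_zero (A : E →L[ℝ] E) : operatorGroup A 0 = 1 := by
  simp [operatorGroup]

theorem hasDerivAt_operatorGroup (A : E →L[ℝ] E) (t : ℝ) :
    HasDerivAt (operatorGroup A) (A * operatorGroup A t) t :=
  hasDerivAt_exp_smul_const' A t

/-- Product rule. When A is the generator and B is multiplication, the bracket is the carré du champ
of P_{t-s} f. -/
theorem hasDerivAt_exp_bilinear (A : E →L[ℝ] E) (B : E →L[ℝ] E →L[ℝ] E) (f : E) (t s : ℝ) :
    HasDerivAt (fun r : ℝ => operatorGroup A r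
        (B (operatorGroup A (t - r) f) (operatorGroup A (t - r) f)))
      (operatorGroup A s
        (A (B (operatorGroup A (t - s) f) (operatorGroup A (t - s) f))
          - B (A (operatorGroup A (t - s) f)) (operatorGroup A (t - s) f)
          - B (operatorGroup A (t - s) f) (A (operatorGroup A (t - s) f)))) s := by
  have h1 : HasDerivAt (fun r : ℝ => operatorGroup A r) (operatorGroup A s * A) s :=
    hasDerivAt_exp_smul_const A s
  have h2 : HasDerivAt (fun r : ℝ => operatorGroup A (t - r) f)
      (-(A (operatorGroup A (t - s) f))) s := by
    have h := (hasDerivAt_operatorGroup A (t - s)).scomp s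
      ((hasDerivAt_id s).const_sub t)
    have h' := h.clm_apply (hasDerivAt_const s f)
    simpa using h'
  have h3 : HasDerivAt
      (fun r : ℝ => B (operatorGroup A (t - r) f) (operatorGroup A (t - r) f))
      (B (-(A (operatorGroup A (t - s) f))) (operatorGroup A (t - s) f)
        + B (operatorGroup A (t - s) f) (-(A (operatorGroup A (t - s) f)))) s :=
    ((B.hasFDerivAt.comp_hasDerivAt s h2).clm_apply h2)
  refine (h1.clm_apply h3).congr_deriv ?_
  simp only [map_neg, map_add, map_sub, neg_apply, mul_apply_eq_comp]
  abel

end SemigroupDerivative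

/-! ### The local Poincaré inequality. -/

section LocalPoincare

variable {G : Type*} [Group G] [TopologicalSpace G] [DiscreteTopology G]

theorem sum_apply_bcf {ι : Type*} (s : Finset ι) (f : ι → G →ᵇ ℝ) (x : G) :
    (∑ i ∈ s, f i) x = ∑ i ∈ s, f i x := by
  simp

theorem carreDuChamp_eq (μ : G →₀ ℝ≥0) (u : G →ᵇ ℝ) :
    walkGenerator μ (u * u) - walkGenerator μ u * u - u * walkGenerator μ u =
      ∑ z ∈ μ.support, (μ z : ℝ) • ((translation z u - u) * (translation z u - u)) := by
  ext x
  rw [sum_apply_bcf]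
  simp only [BoundedContinuousFunction.sub_apply, BoundedContinuousFunction.mul_apply,
    walkGenerator_apply, BoundedContinuousFunction.smul_apply, translation_apply, smul_eq_mul,
    Finset.sum_mul, Finset.mul_sum, ← Finset.sum_sub_distrib]
  exact Finset.sum_congr rfl fun z _ => by ring

/-- The local Poincaré inequality for walks with conjugacy-invariant jump measure. -/
theorem walkSemigroup_sq_sub_sq_le {μ : G →₀ ℝ≥0} (hμ : ∀ x z : G, μ (x * z * x⁻¹) = μ z)
    (t : ℝ≥0) (f : G →ᵇ ℝ) (x : G) :
    walkSemigroup μ t (f * f) x - (walkSemigroup μ t f x) ^ 2 ≤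
      t * ∑ z ∈ μ.support, (μ z : ℝ) *
        walkSemigroup μ t ((translation z f - f) * (translation z f - f)) x := by
  set C := ∑ z ∈ μ.support, (μ z : ℝ) *
        walkSemigroup μ t ((translation z f - f) * (translation z f - f)) x with hC
  let F : ℝ → ℝ := fun r => operatorGroup (walkGenerator μ) r
        (ContinuousLinearMap.mul ℝ (G →ᵇ ℝ) (operatorGroup (walkGenerator μ) ((t : ℝ) - r) f)
          (operatorGroup (walkGenerator μ) ((t : ℝ) - r) f)) x
  have hF (s : ℝ) := (BoundedContinuousFunction.evalCLM ℝ x).hasFDerivAt.comp_hasDerivAt s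
    (hasDerivAt_exp_bilinear (walkGenerator μ) (ContinuousLinearMap.mul ℝ (G →ᵇ ℝ)) f t s)
  -- Mean value inequality on [0, t]: it suffices that the derivative is at most the constant C.
  have key := (convex_Icc (0 : ℝ) t).image_sub_le_mul_sub_of_deriv_le (f := F) (C := C)
    (fun s _ => (hF s).continuousAt.continuousWithinAt)
    (fun s _ => (hF s).differentiableAt.differentiableWithinAt) ?_ 0 (by simp) t (by simp) t.2
  · have h1 : F t = walkSemigroup μ t (f * f) x := by
      simp only [F, sub_self, operatorGroup_zero, operatorGroup_coe]
      rfl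
    have h0 : F 0 = (walkSemigroup μ t f x) ^ 2 := by
      simp only [F, sub_zero, operatorGroup_zero, operatorGroup_coe, sq]
      rfl
    rw [h1, h0] at key
    linarith
  · intro s hs
    rw [interior_Icc] at hs
    rw [show deriv F s = _ from (hF s).deriv]
    obtain ⟨a, rfl⟩ : ∃ a : ℝ≥0, s = a := ⟨⟨s, hs.1.le⟩, rfl⟩
    obtain ⟨b, hb⟩ : ∃ b : ℝ≥0, (t : ℝ) - a = b := ⟨⟨t - a, by linarith [hs.2]⟩, rfl⟩
    have htab : t = a + b := by
      ext; push_cast; linarith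
    rw [hb]
    have hu : operatorGroup (walkGenerator μ) (b : ℝ) f = walkSemigroup μ b f := rfl
    rw [hu]
    set u := walkSemigroup μ b f with hu'
    have hmul : ∀ v w : G →ᵇ ℝ, ContinuousLinearMap.mul ℝ (G →ᵇ ℝ) v w = v * w := fun _ _ => rfl
    rw [hmul, hmul, hmul, carreDuChamp_eq]
    change walkSemigroup μ a (∑ z ∈ μ.support, (μ z : ℝ) •
      ((translation z u - u) * (translation z u - u))) x ≤ C
    rw [map_sum, sum_apply_bcf, hC]
    refine Finset.sum_le_sum fun z _ => ?_
    rw [map_smul, BoundedContinuousFunction.smul_apply, smul_eq_mul]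
    refine mul_le_mul_of_nonneg_left ?_ (μ z).2
    -- The translation passes through P_b, Jensen moves the square inside P_b, and P_a P_b = P_t.
    have hd : translation z u - u = walkSemigroup μ b (translation z f - f) := by
      rw [map_sub, walkSemigroup_translation hμ, hu']
    have ht : walkSemigroup μ t ((translation z f - f) * (translation z f - f)) =
        walkSemigroup μ a (walkSemigroup μ b ((translation z f - f) * (translation z f - f))) := by
      rw [htab]; exact operatorSemigroup_add_time _ _ _ _
    rw [ht, hd]
    refine (isPositiveOp_walkSemigroup μ a).mono (fun y => ?_) x
    rw [BoundedContinuousFunction.mul_apply, ← sq]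
    exact sq_walkSemigroup_le μ b _ y

end LocalPoincare

/-! ### Poisson mixtures and their shifts. -/

section Poisson

theorem hasSum_poisson (s : ℝ) :
    HasSum (fun n : ℕ => Real.exp (-s) * s ^ n / n.factorial) 1 := by
  have h := (NormedSpace.expSeries_div_hasSum_exp (𝔸 := ℝ) s).mul_left (Real.exp (-s))
  rw [← Real.exp_eq_exp_ℝ, ← Real.exp_add, neg_add_cancel, Real.exp_zero] at h
  simpa only [mul_div_assoc] using h

/-- The Stein identity E[N f(N)] = s E f(N + 1) of the Poisson law. -/
theorem hasSum_poisson_mul (s : ℝ) {f : ℕ → ℝ} {c : ℝ}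
    (h : HasSum (fun n : ℕ => Real.exp (-s) * s ^ n / n.factorial * f (n + 1)) c) :
    HasSum (fun n : ℕ => Real.exp (-s) * s ^ n / n.factorial * (n * f n)) (s * c) := by
  have e (n : ℕ) : Real.exp (-s) * s ^ (n + 1) / (n + 1).factorial * ((n + 1 : ℕ) * f (n + 1)) =
      s * (Real.exp (-s) * s ^ n / n.factorial * f (n + 1)) := by
    rw [Nat.factorial_succ]
    have : (n.factorial : ℝ) ≠ 0 := by positivity
    push_cast
    field_simp
    ring
  rw [← hasSum_nat_add_iff' 1]
  simp only [Finset.range_one, Finset.sum_singleton, Nat.cast_zero, zero_mul, mul_zero, sub_zero, e]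
  exact h.mul_left s

theorem hasSum_poisson_sq (s : ℝ) :
    HasSum (fun n : ℕ => Real.exp (-s) * s ^ n / n.factorial * ((n : ℝ) + 1 - s) ^ 2) (s + 1) := by
  have h0 := hasSum_poisson s
  have h1 := hasSum_poisson_mul s (f := fun _ => 1) (c := 1) (by simpa using h0)
  have h2 := hasSum_poisson_mul s (f := fun n => n - 1) (c := s) (by simpa using h1)
  -- (n + 1 - s)² = n(n - 1) + (3 - 2s) n + (1 - s)².
  have h := (h2.add (h1.mul_left (3 - 2 * s))).add (h0.mul_left ((1 - s) ^ 2))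
  convert h using 1
  · ext n
    ring
  · ring

/-- If `q` is a Poisson mixture of the weights `a` and `q'` dominates the mixture with weights
`s / (n + 1)`, then `q / q'` is controlled by the conditional quadratic deviation `S / q`. -/
theorem poisson_mixture_ratio {s : ℝ} (hs : 0 < s) {p a : ℕ → ℝ} (hp : ∀ n, 0 ≤ p n)
    (ha : ∀ n, 0 ≤ a n) {q q' R S : ℝ} (hq : HasSum (fun n => p n * a n) q)
    (hR : HasSum (fun n : ℕ => p n * a n * (s / (n + 1))) R) (hRq : R ≤ q')
    (hS : HasSum (fun n : ℕ => p n * a n * ((n : ℝ) + 1 - s) ^ 2) S) (hq0 : 0 < q) :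
    0 < q' ∧ q / q' ≤ 1 + √(S / q) / s := by
  have hpa (n : ℕ) : 0 ≤ p n * a n := mul_nonneg (hp n) (ha n)
  obtain ⟨D, hD⟩ : Summable (fun n : ℕ => p n * a n * ((n : ℝ) + 1 - s)) := by
    refine Summable.of_norm_bounded (hq.summable.add hS.summable) fun n => ?_
    rw [Real.norm_eq_abs, abs_mul, abs_of_nonneg (hpa n), ← mul_one_add]
    refine mul_le_mul_of_nonneg_left ?_ (hpa n)
    rw [abs_le]
    constructor <;> nlinarith [sq_nonneg ((n : ℝ) + 1 - s + 1), sq_nonneg ((n : ℝ) + 1 - s - 1)]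
  have hM : HasSum (fun n : ℕ => p n * a n * (((n : ℝ) + 1) / s)) (q + D / s) := by
    convert hq.add (hD.div_const s) using 2
    field_simp
    ring
  -- Cauchy–Schwarz, by expanding ∑ p a (q (n + 1 - s) - D)² ≥ 0.
  have hcs : D ^ 2 ≤ S * q := by
    have h := ((hS.mul_left (q ^ 2)).sub (hD.mul_left (2 * q * D))).add (hq.mul_left (D ^ 2))
    have h' := h.nonneg fun n => by
      have := mul_nonneg (hpa n) (sq_nonneg (q * ((n : ℝ) + 1 - s) - D))
      nlinarith
    have : 0 ≤ q * (S * q - D ^ 2) := by nlinarith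
    nlinarith [nonneg_of_mul_nonneg_right this hq0]
  set M := q + D / s with hMdef
  have hM0 : 0 < M := by
    have h : q / s ≤ M := by
      refine hasSum_le (fun n => ?_) (hq.div_const s) hM
      rw [mul_div_assoc']
      refine div_le_div_of_nonneg_right ?_ hs.le
      have : (0 : ℝ) ≤ n := Nat.cast_nonneg n
      nlinarith [hpa n, mul_nonneg (hpa n) this]
    exact lt_of_lt_of_le (by positivity) h
  -- Jensen for y ↦ 1/y with y = (n + 1)/s, through the tangent bound 1/y ≥ 2c - c² y at c = q/M.
  have hqM : q ^ 2 / M ≤ q' := by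
    refine le_trans ?_ hRq
    have h := (hq.mul_left (2 * (q / M))).sub (hM.mul_left ((q / M) ^ 2))
    have h' := hasSum_le (fun n => ?_) h hR
    · convert h' using 1
      field_simp
      ring
    · have hy : (0 : ℝ) < ((n : ℝ) + 1) / s := by positivity
      have : 2 * (q / M) - (q / M) ^ 2 * (((n : ℝ) + 1) / s) ≤ s / (n + 1) := by
        rw [show s / ((n : ℝ) + 1) = 1 / (((n : ℝ) + 1) / s) by field_simp, le_div_iff₀ hy]
        nlinarith [sq_nonneg (q / M * (((n : ℝ) + 1) / s) - 1)]
      nlinarith [mul_le_mul_of_nonneg_left this (hpa n)]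
  have hq'0 : 0 < q' := lt_of_lt_of_le (by positivity) hqM
  refine ⟨hq'0, ?_⟩
  have h1 : q / q' ≤ M / q := by
    rw [div_le_div_iff₀ hq'0 hq0]
    rw [div_le_iff₀ hM0] at hqM
    nlinarith
  refine h1.trans ?_
  rw [hMdef, add_div, div_self hq0.ne', div_div, mul_comm s q, ← div_div]
  gcongr
  refine Real.le_sqrt_of_sq_le ?_
  rw [div_pow, div_le_div_iff₀ (by positivity) hq0]
  nlinarith

/-- Monotonicity for v ≤ 1 and Bernoulli's inequality 1 + wv ≤ (1 + w)^v for v ≥ 1. The right side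
is affine in v², so it can be averaged. -/
theorem sq_log_one_add_mul_le {w v : ℝ} (hw : 0 ≤ w) (hv : 0 ≤ v) :
    Real.log (1 + w * v) ^ 2 ≤ (1 + v ^ 2) * Real.log (1 + w) ^ 2 := by
  have hL : 0 ≤ Real.log (1 + w) := Real.log_nonneg (by linarith)
  have hL' : 0 ≤ Real.log (1 + w * v) := Real.log_nonneg (by nlinarith [mul_nonneg hw hv])
  rcases le_total v 1 with h | h
  · have : Real.log (1 + w * v) ≤ Real.log (1 + w) :=
      Real.log_le_log (by positivity) (by nlinarith)
    nlinarith [mul_nonneg (sq_nonneg v) (sq_nonneg (Real.log (1 + w)))]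
  · have : Real.log (1 + w * v) ≤ v * Real.log (1 + w) := by
      rw [← Real.log_rpow (by linarith)]
      refine Real.log_le_log (by positivity) ?_
      rw [mul_comm w v]
      exact one_add_mul_self_le_rpow_one_add (by linarith) h
    nlinarith [sq_nonneg (Real.log (1 + w)), mul_nonneg hv hL]

/-- Taking w = √(s+1)/s and v² = S/(q(s+1)) makes the bound linear in q and S, ready to be summed
over the group. -/
theorem poisson_mixture_log {s : ℝ} (hs : 0 < s) {p a : ℕ → ℝ} (hp : ∀ n, 0 ≤ p n)
    (ha : ∀ n, 0 ≤ a n) {q q' R S : ℝ} (hq : HasSum (fun n => p n * a n) q)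
    (hR : HasSum (fun n : ℕ => p n * a n * (s / (n + 1))) R) (hRq : R ≤ q')
    (hS : HasSum (fun n : ℕ => p n * a n * ((n : ℝ) + 1 - s) ^ 2) S) :
    q * (max 0 (Real.log q - Real.log q')) ^ 2 ≤
      Real.log (1 + √(s + 1) / s) ^ 2 * (q + S / (s + 1)) := by
  have hS0 : 0 ≤ S := hS.nonneg fun n => mul_nonneg (mul_nonneg (hp n) (ha n)) (sq_nonneg _)
  rcases (hq.nonneg fun n => mul_nonneg (hp n) (ha n)).eq_or_lt with h | hq0
  · rw [← h]
    rw [zero_mul]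
    positivity
  obtain ⟨hq', hle⟩ := poisson_mixture_ratio hs hp ha hq hR hRq hS hq0
  have hs1 : 0 < √(s + 1) := Real.sqrt_pos.2 (by linarith)
  have hw : 1 + √(S / q) / s = 1 + √(s + 1) / s * (√(S / q) / √(s + 1)) := by
    field_simp
  have h1 : max 0 (Real.log q - Real.log q') ≤ Real.log (1 + √(S / q) / s) := by
    refine max_le (Real.log_nonneg ?_) ?_
    · have : 0 ≤ √(S / q) / s := by positivity
      linarith
    · rw [← Real.log_div hq0.ne' hq'.ne']
      exact Real.log_le_log (by positivity) hle
  have h2 : (max 0 (Real.log q - Real.log q')) ^ 2 ≤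
      (1 + (√(S / q) / √(s + 1)) ^ 2) * Real.log (1 + √(s + 1) / s) ^ 2 := by
    refine le_trans (pow_le_pow_left₀ (le_max_left _ _) h1 2) ?_
    rw [hw]
    exact sq_log_one_add_mul_le (by positivity) (by positivity)
  rw [div_pow, Real.sq_sqrt (by positivity), Real.sq_sqrt (by positivity)] at h2
  calc _ ≤ q * ((1 + S / q / (s + 1)) * Real.log (1 + √(s + 1) / s) ^ 2) := by gcongr
    _ = _ := by field_simp

theorem sq_log_le_varentBound {s : ℝ} (hs : 0 < s) :
    s * Real.log (1 + √(s + 1) / s) ^ 2 ≤ 4 * varentBound s := by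
  have hs' : 0 < √s := Real.sqrt_pos.2 hs
  have h1 : √(s + 1) ≤ √s + 1 := by
    rw [Real.sqrt_le_left (by positivity)]
    nlinarith [Real.sq_sqrt hs.le]
  have h2 : 1 + √(s + 1) / s ≤ (1 + 1 / √s) ^ 2 := by
    have : √(s + 1) / s ≤ (√s + 1) / s := by gcongr
    have h3 : (√s + 1) / s = 1 / √s + 1 / s := by
      rw [add_div, Real.sqrt_div_self']
    have h4 : (1 + 1 / √s) ^ 2 = 1 + 2 * (1 / √s) + 1 / s := by
      have : (1 / √s) ^ 2 = 1 / s := by rw [div_pow, Real.sq_sqrt hs.le, one_pow]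
      nlinarith
    have : 0 < 1 / √s := by positivity
    linarith
  have h0 : 0 ≤ √(s + 1) / s := by positivity
  have h5 : Real.log (1 + √(s + 1) / s) ≤ 2 * Real.log (1 + 1 / √s) := by
    have := Real.log_le_log (by positivity) h2
    rwa [Real.log_pow, Nat.cast_ofNat] at this
  have h6 : 0 ≤ Real.log (1 + √(s + 1) / s) := Real.log_nonneg (by linarith)
  rw [varentBound]
  have := pow_le_pow_left₀ h6 h5 2
  nlinarith

end Poisson

/-! ### Transition probabilities and their logarithmic decrements along a jump. -/

section HeatKernel

variable {G : Type*} [Group G] [TopologicalSpace G] [DiscreteTopology G]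

/-- The indicator function of a set as a bounded function on a discrete space. -/
def setIndicator (s : Set G) : G →ᵇ ℝ :=
  BoundedContinuousFunction.indicator s (isClopen_discrete s)

theorem setIndicator_apply (s : Set G) (x : G) [Decidable (x ∈ s)] :
    setIndicator s x = if x ∈ s then 1 else 0 := by
  simp [setIndicator, Set.indicator_apply]

theorem setIndicator_nonneg (s : Set G) (x : G) : 0 ≤ setIndicator s x := by
  classical
  rw [setIndicator_apply]
  split_ifs <;> norm_num

/-- The transition probability from `1` to `x` at time `t`. -/
def heatKernel (μ : G →₀ ℝ≥0) (t : ℝ≥0) (x : G) : ℝ :=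
  walkSemigroup μ t (setIndicator {x}) 1

theorem walkSemigroup_setIndicator_nonneg (μ : G →₀ ℝ≥0) (t : ℝ≥0) (s : Set G) (y : G) :
    0 ≤ walkSemigroup μ t (setIndicator s) y :=
  isPositiveOp_walkSemigroup μ t _ (setIndicator_nonneg s) y

theorem sum_walkSemigroup_singleton_le_one (μ : G →₀ ℝ≥0) (t : ℝ≥0) (F : Finset G) (y : G) :
    ∑ x ∈ F, walkSemigroup μ t (setIndicator {x}) y ≤ 1 := by
  classical
  rw [← sum_apply_bcf, ← map_sum]
  have h := (isPositiveOp_walkSemigroup μ t).mono (f := ∑ x ∈ F, setIndicator {x})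
    (g := BoundedContinuousFunction.const G 1) (fun z => ?_) y
  · rwa [walkSemigroup_const] at h
  · rw [sum_apply_bcf]
    simp only [setIndicator_apply, Set.mem_singleton_iff, Finset.sum_ite_eq,
      BoundedContinuousFunction.const_apply]
    split_ifs <;> norm_num

theorem heatKernel_nonneg (μ : G →₀ ℝ≥0) (t : ℝ≥0) (x : G) : 0 ≤ heatKernel μ t x :=
  walkSemigroup_setIndicator_nonneg μ t _ 1

theorem sum_heatKernel_le_one (μ : G →₀ ℝ≥0) (t : ℝ≥0) (F : Finset G) :
    ∑ x ∈ F, heatKernel μ t x ≤ 1 :=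
  sum_walkSemigroup_singleton_le_one μ t F 1

theorem heatKernel_le_one (μ : G →₀ ℝ≥0) (t : ℝ≥0) (x : G) : heatKernel μ t x ≤ 1 := by
  simpa using sum_heatKernel_le_one μ t {x}

theorem translation_setIndicator_singleton (z x : G) :
    translation z (setIndicator {x}) = setIndicator {x * z⁻¹} := by
  classical
  ext y
  simp [setIndicator_apply, eq_mul_inv_iff_mul_eq]

/-- Splitting off the jumps along one element `e` with rate at most `μ e`. -/
theorem exists_walkSemigroup_factor {μ : G →₀ ℝ≥0} (hμ : ∀ x z : G, μ (x * z * x⁻¹) = μ z)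
    {e : G} {r : ℝ≥0} (hr : r ≤ μ e) : ∃ μ' : G →₀ ℝ≥0, ∀ (t : ℝ≥0) (f : G →ᵇ ℝ),
      walkSemigroup μ' t (translation e f) = translation e (walkSemigroup μ' t f) ∧
      walkSemigroup μ t f = walkSemigroup (Finsupp.single e r) t (walkSemigroup μ' t f) := by
  classical
  obtain ⟨μ', rfl⟩ : ∃ μ', μ = Finsupp.single e r + μ' := by
    refine ⟨μ - Finsupp.single e r, (add_tsub_cancel_of_le ?_).symm⟩
    exact Finsupp.single_le_iff.2 hr
  -- μ' need not be conjugacy-invariant, but its generator differs from that of μ by a multiple of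
  -- T_e - 1, so it still commutes with T_e.
  have h (g : G →ᵇ ℝ) : walkGenerator μ' (translation e g) = translation e (walkGenerator μ' g) := by
    have h1 := walkGenerator_translation hμ e g
    rw [walkGenerator_add, walkGenerator_single] at h1
    simp only [add_apply, smul_apply, sub_apply, map_add, map_smul, map_sub] at h1
    exact add_left_cancel h1
  refine ⟨μ', fun t f => ⟨operatorSemigroup_commute h t f,
    walkSemigroup_add_apply (fun g => ?_) t f⟩⟩
  rw [walkGenerator_single]
  simp only [smul_apply, sub_apply, map_smul, map_sub, h]
  rfl

/-- In the proof, a x n is the probability that the walk without the split-off jumps leads from e^n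
to x. For fixed n these sum to at most 1, so the S x sum to at most E(N+1-s)² = s + 1. -/
theorem heatKernel_mul_right_pos_and_sum_le {μ : G →₀ ℝ≥0} (hμ : ∀ x z : G, μ (x * z * x⁻¹) = μ z)
    {e : G} {r : ℝ≥0} (hr : r ≤ μ e) {t : ℝ≥0} (hs : 0 < (r * t : ℝ)) :
    (∀ x, 0 < heatKernel μ t x → 0 < heatKernel μ t (x * e)) ∧ ∀ F : Finset G, ∑ x ∈ F, heatKernel μ t x *
        (max 0 (Real.log (heatKernel μ t x) - Real.log (heatKernel μ t (x * e)))) ^ 2 ≤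
      2 * Real.log (1 + √((r * t : ℝ) + 1) / (r * t)) ^ 2 := by
  obtain ⟨μ', hfac⟩ := exists_walkSemigroup_factor hμ hr
  set s : ℝ := r * t with hsdef
  set p : ℕ → ℝ := fun n => Real.exp (-s) * s ^ n / n.factorial with hp
  have hp0 (n : ℕ) : 0 ≤ p n := by positivity
  set a : G → ℕ → ℝ := fun x n => walkSemigroup μ' t (setIndicator {x}) (e ^ n) with ha
  have ha0 (x : G) (n : ℕ) : 0 ≤ a x n := walkSemigroup_setIndicator_nonneg _ _ _ _
  have ha1' (x : G) (n : ℕ) : a x n ≤ 1 := by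
    simpa using sum_walkSemigroup_singleton_le_one μ' t {x} (e ^ n)
  have hq (x : G) : HasSum (fun n => p n * a x n) (heatKernel μ t x) := by
    have h := hasSum_walkSemigroup_single e r t (walkSemigroup μ' t (setIndicator {x})) 1
    rw [← (hfac t _).2] at h
    simp only [one_mul] at h
    exact h
  have hP2 := hasSum_poisson_sq s
  have hSsum (x : G) : Summable (fun n : ℕ => p n * a x n * ((n : ℝ) + 1 - s) ^ 2) := by
    refine Summable.of_nonneg_of_le (fun n => ?_) (fun n => ?_) hP2.summable
    · exact mul_nonneg (mul_nonneg (hp0 n) (ha0 x n)) (sq_nonneg _)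
    · exact mul_le_mul_of_nonneg_right (mul_le_of_le_one_right (hp0 n) (ha1' x n)) (sq_nonneg _)
  set S : G → ℝ := fun x => ∑' n : ℕ, p n * a x n * ((n : ℝ) + 1 - s) ^ 2 with hSdef
  have hS (x : G) := (hSsum x).hasSum
  have hbound (x : G) : (0 < heatKernel μ t x → 0 < heatKernel μ t (x * e)) ∧ heatKernel μ t x *
        (max 0 (Real.log (heatKernel μ t x) - Real.log (heatKernel μ t (x * e)))) ^ 2 ≤
      Real.log (1 + √(s + 1) / s) ^ 2 * (heatKernel μ t x + S x / (s + 1)) := by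
    have hR : Summable (fun n : ℕ => p n * a x n * (s / (n + 1))) := by
      refine Summable.of_nonneg_of_le (fun n => ?_) (fun n => ?_) ((hq x).summable.mul_right s)
      · exact mul_nonneg (mul_nonneg (hp0 n) (ha0 x n)) (by positivity)
      · refine mul_le_mul_of_nonneg_left ?_ (mul_nonneg (hp0 n) (ha0 x n))
        exact div_le_self hs.le (by linarith [Nat.cast_nonneg (α := ℝ) n])
    suffices hle : ∑' n : ℕ, p n * a x n * (s / (n + 1)) ≤ heatKernel μ t (x * e) from
      ⟨fun h => (poisson_mixture_ratio hs hp0 (ha0 x) (hq x) hR.hasSum hle (hS x) h).1,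
        poisson_mixture_log hs hp0 (ha0 x) (hq x) hR.hasSum hle (hS x)⟩
    -- One more split-off jump translates the target by e, because the remaining walk commutes with
    -- T_e.
    have hshift (n : ℕ) : a (x * e) (n + 1) = a x n := by
      have hx : setIndicator {x} = translation e (setIndicator {x * e}) := by
        rw [translation_setIndicator_singleton, mul_inv_cancel_right]
      simp only [ha]
      rw [hx, (hfac t _).1, translation_apply, pow_succ]
    have h2 := (hasSum_nat_add_iff' 1).2 (hq (x * e))
    have h3 : ∑' n : ℕ, p n * a x n * (s / (n + 1)) =
        heatKernel μ t (x * e) - ∑ i ∈ Finset.range 1, p i * a (x * e) i := by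
      rw [← h2.tsum_eq]
      refine tsum_congr fun n => ?_
      rw [hshift, hp]
      simp only [Nat.factorial_succ, pow_succ]
      push_cast
      have : (n.factorial : ℝ) ≠ 0 := by positivity
      field_simp
    rw [h3, Finset.sum_range_one]
    linarith [mul_nonneg (hp0 0) (ha0 (x * e) 0)]
  refine ⟨fun x => (hbound x).1, fun F => ?_⟩
  have ha1 (n : ℕ) : ∑ x ∈ F, a x n ≤ 1 := sum_walkSemigroup_singleton_le_one μ' t F (e ^ n)
  have hSle : ∑ x ∈ F, S x ≤ s + 1 := by
    refine hasSum_le (fun n => ?_) (hasSum_sum fun x _ => hS x) hP2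
    rw [← Finset.sum_mul, ← Finset.mul_sum]
    exact mul_le_mul_of_nonneg_right (mul_le_of_le_one_right (hp0 n) (ha1 n)) (sq_nonneg _)
  calc _ ≤ ∑ x ∈ F, Real.log (1 + √(s + 1) / s) ^ 2 * (heatKernel μ t x + S x / (s + 1)) :=
        Finset.sum_le_sum fun x _ => (hbound x).2
    _ = Real.log (1 + √(s + 1) / s) ^ 2 *
          (∑ x ∈ F, heatKernel μ t x + (∑ x ∈ F, S x) / (s + 1)) := by
        rw [← Finset.mul_sum, Finset.sum_add_distrib, Finset.sum_div]
    _ ≤ Real.log (1 + √(s + 1) / s) ^ 2 * (1 + 1) := by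
        gcongr
        · exact sum_heatKernel_le_one μ t F
        · rw [div_le_one (by linarith)]
          exact hSle
    _ = _ := by ring

end HeatKernel

/-! ### The law of the walk at a fixed time. -/

section Law

variable {G : Type*} [Group G] [TopologicalSpace G] [DiscreteTopology G]
  {Ω : Type*} [MeasurableSpace Ω] {P : Measure Ω} [IsProbabilityMeasure P]

theorem IsRandomWalk.integral_apply {μ : G →₀ ℝ≥0} {X : ℝ≥0 → Ω → G} (hX : IsRandomWalk μ P X)
    (t : ℝ≥0) (f : G →ᵇ ℝ) : ∫ ω, f (X t ω) ∂P = walkSemigroup μ t f 1 := by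
  have hm : pastUpTo X 0 ≤ ‹MeasurableSpace Ω› :=
    iSup_le fun r => (hX.measurable r).comap_le
  have h := hX.markov 0 t f
  rw [zero_add] at h
  rw [← integral_condExp hm, integral_congr_ae h]
  have h0 : (fun ω => walkSemigroup μ t f (X 0 ω)) =ᵐ[P] fun _ => walkSemigroup μ t f 1 := by
    filter_upwards [hX.start] with ω hω
    rw [hω]
  rw [integral_congr_ae h0]
  simp

/-- `Y` is distributed as the walk with jump measure `μ` at time `t`. -/
structure HasWalkLaw (μ : G →₀ ℝ≥0) (t : ℝ≥0) (P : Measure Ω) (Y : Ω → G) : Prop where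
  measurable : Measurable[_, ⊤] Y
  integral_eq : ∀ f : G →ᵇ ℝ, ∫ ω, f (Y ω) ∂P = walkSemigroup μ t f 1

theorem IsRandomWalk.hasWalkLaw {μ : G →₀ ℝ≥0} {X : ℝ≥0 → Ω → G} (hX : IsRandomWalk μ P X)
    (t : ℝ≥0) : HasWalkLaw μ t P (X t) :=
  ⟨hX.measurable t, hX.integral_apply t⟩

namespace HasWalkLaw

variable {μ : G →₀ ℝ≥0} {t : ℝ≥0} {Y : Ω → G} (hY : HasWalkLaw μ t P Y)

include hY

theorem measurableSet_preimage (s : Set G) : MeasurableSet (Y ⁻¹' s) :=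
  hY.measurable trivial

theorem measurable_comp {β : Type*} [MeasurableSpace β] (f : G → β) :
    Measurable fun ω => f (Y ω) :=
  (measurable_from_top (f := f)).comp hY.measurable

theorem real_preimage (s : Set G) : P.real (Y ⁻¹' s) = walkSemigroup μ t (setIndicator s) 1 := by
  rw [← hY.integral_eq, ← integral_indicator_one (hY.measurableSet_preimage s)]
  rfl

theorem real_preimage_singleton (x : G) : P.real (Y ⁻¹' {x}) = heatKernel μ t x :=
  hY.real_preimage {x}

/-- G may be uncountable, but the walk stays in the countable subgroup generated by the support of
μ: the indicator of that subgroup is invariant under all jumps. This permits writing integrals as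
sums. -/
theorem exists_countable : ∃ H : Set G, H.Countable ∧ ∀ᵐ ω ∂P, Y ω ∈ H := by
  classical
  let φ : FreeGroup μ.support →* G := FreeGroup.lift fun z => (z : G)
  refine ⟨φ.range, ?_, ?_⟩
  · rw [MonoidHom.coe_range]
    have : Countable (FreeGroup μ.support) :=
      inferInstanceAs (Countable (Quot _))
    exact Set.countable_range φ
  · have h1 : P.real (Y ⁻¹' φ.range) = 1 := by
      rw [hY.real_preimage, walkSemigroup_apply_of_invariant]
      · exact (setIndicator_apply _ _).trans (if_pos (one_mem φ.range))
      · intro z hz x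
        have : z ∈ φ.range := ⟨FreeGroup.of ⟨z, hz⟩, by simp [φ]⟩
        simp only [setIndicator_apply, SetLike.mem_coe, Subgroup.mul_mem_cancel_right _ this]
    have h2 : P (Y ⁻¹' φ.range) = 1 := by
      rwa [measureReal_def, ENNReal.toReal_eq_one_iff] at h1
    exact (prob_compl_eq_zero_iff (hY.measurableSet_preimage _)).2 h2

theorem lintegral_le {h : G → ℝ≥0∞} {C : ℝ≥0∞}
    (hC : ∀ F : Finset G, ∑ x ∈ F, h x * ENNReal.ofReal (heatKernel μ t x) ≤ C) :
    ∫⁻ ω, h (Y ω) ∂P ≤ C := by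
  classical
  obtain ⟨H, hH, hYH⟩ := hY.exists_countable
  let _ : MeasurableSpace G := ⊤
  have hYm : Measurable Y := hY.measurable
  have hae : ∀ᵐ x ∂(P.map Y), x ∈ H := (ae_map_iff hYm.aemeasurable trivial).2 hYH
  rw [← lintegral_map (measurable_from_top (f := h)) hYm, ← Measure.restrict_eq_self_of_ae_mem hae,
    lintegral_countable _ hH, ENNReal.tsum_eq_iSup_sum]
  refine iSup_le fun F => ?_
  refine le_trans (le_of_eq ?_) (hC (F.map (Function.Embedding.subtype _)))
  rw [Finset.sum_map]
  refine Finset.sum_congr rfl fun x _ => ?_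
  rw [Measure.map_apply hYm trivial, Function.Embedding.subtype_apply,
    ← hY.real_preimage_singleton, ofReal_measureReal]

theorem evariance_comp_le (hμ : ∀ x z : G, μ (x * z * x⁻¹) = μ z) (f : G →ᵇ ℝ) :
    evariance (fun ω => f (Y ω)) P ≤ ENNReal.ofReal (t * ∑ z ∈ μ.support, (μ z : ℝ) *
      ∫ ω, (f (Y ω * z) - f (Y ω)) ^ 2 ∂P) := by
  have hm : MemLp (fun ω => f (Y ω)) 2 P :=
    MemLp.of_bound (hY.measurable_comp f).aestronglyMeasurable ‖f‖
      (Filter.Eventually.of_forall fun ω => f.norm_coe_le_norm _)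
  rw [← ofReal_variance hm, variance_eq_sub hm]
  refine ENNReal.ofReal_le_ofReal ?_
  have h := walkSemigroup_sq_sub_sq_le hμ t f 1
  simp only [← hY.integral_eq] at h
  simpa [sq] using h

end HasWalkLaw

end Law

/-! ### Variance of a possibly non-integrable variable from its truncations. -/

section Truncation

variable {Ω : Type*} [MeasurableSpace Ω] {P : Measure Ω} [IsProbabilityMeasure P]

theorem evariance_le_lintegral_sub {Y : Ω → ℝ} (hY : Measurable Y) (m : ℝ) :
    evariance Y P ≤ ∫⁻ ω, ENNReal.ofReal ((Y ω - m) ^ 2) ∂P := by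
  by_cases h : ∫⁻ ω, ENNReal.ofReal ((Y ω - m) ^ 2) ∂P = ∞
  · rw [h]; exact le_top
  have hZ : MemLp (fun ω => Y ω - m) 2 P := by
    rw [memLp_two_iff_integrable_sq (hY.sub_const m).aestronglyMeasurable]
    refine ⟨((hY.sub_const m).pow_const 2).aestronglyMeasurable, ?_⟩
    rw [hasFiniteIntegral_iff_ofReal (Filter.Eventually.of_forall fun ω => sq_nonneg _)]
    exact lt_top_iff_ne_top.2 h
  have hY2 : MemLp Y 2 P := by
    have h' := hZ.add (memLp_const m)
    have e : ((fun ω => Y ω - m) + fun _ => m) = Y := by ext ω; simp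
    rwa [e] at h'
  rw [← ofReal_variance hY2, ← variance_sub_const hY.aestronglyMeasurable m]
  rw [← ofReal_integral_eq_lintegral_ofReal hZ.integrable_sq
    (Filter.Eventually.of_forall fun ω => sq_nonneg _)]
  exact ENNReal.ofReal_le_ofReal
    (variance_le_expectation_sq (hY.sub_const m).aestronglyMeasurable)

/-- A bound on the variance of all truncations of a nonpositive variable bounds its variance. -/
theorem evariance_le_of_forall_truncation {Y : Ω → ℝ} (hY : Measurable Y) (hY0 : ∀ ω, Y ω ≤ 0)
    {B : ℝ} (hB : ∀ M : ℕ, evariance (fun ω => max (Y ω) (-M)) P ≤ ENNReal.ofReal B) :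
    evariance Y P ≤ ENNReal.ofReal B := by
  have hYM (M : ℕ) : Measurable fun ω => max (Y ω) (-(M : ℝ)) := hY.max measurable_const
  have hbd (M : ℕ) (ω : Ω) : ‖max (Y ω) (-(M : ℝ))‖ ≤ M := by
    rw [Real.norm_eq_abs, abs_le]
    exact ⟨le_max_right _ _, (max_le (hY0 ω) (by simp)).trans (Nat.cast_nonneg M)⟩
  set m : ℕ → ℝ := fun M => ∫ ω, max (Y ω) (-(M : ℝ)) ∂P with hm
  have hm0 (M : ℕ) : m M ≤ 0 :=
    integral_nonpos fun ω => max_le (hY0 ω) (by simp)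
  obtain ⟨n, hn⟩ : ∃ n : ℕ, 0 < P.real {ω | -(n : ℝ) ≤ Y ω} := by
    by_contra! hcon
    have h0 (n : ℕ) : P {ω | -(n : ℝ) ≤ Y ω} = 0 := by
      have := le_antisymm (hcon n) measureReal_nonneg
      rwa [measureReal_eq_zero_iff] at this
    have hU : (⋃ n : ℕ, {ω | -(n : ℝ) ≤ Y ω}) = Set.univ := by
      ext ω
      obtain ⟨k, hk⟩ := exists_nat_ge (-(Y ω))
      simp only [Set.mem_iUnion, Set.mem_ofPred_eq, Set.mem_univ, iff_true]
      exact ⟨k, by linarith⟩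
    have := measure_iUnion_null h0
    rw [hU] at this
    simp at this
  set p := P.real {ω | -(n : ℝ) ≤ Y ω} with hp
  have hms : MeasurableSet {ω | -(n : ℝ) ≤ Y ω} := measurableSet_le measurable_const hY
  have hB' (M : ℕ) : ∫ ω, (max (Y ω) (-(M : ℝ)) - m M) ^ 2 ∂P ≤ max B 0 := by
    have h2 : MemLp (fun ω => max (Y ω) (-(M : ℝ))) 2 P :=
      MemLp.of_bound (hYM M).aestronglyMeasurable M (Filter.Eventually.of_forall (hbd M))
    have := hB M
    rw [← ofReal_variance h2] at this
    rw [← variance_eq_integral (hYM M).aemeasurable]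
    have h3 := ENNReal.ofReal_le_ofReal_iff'.1 this
    rcases h3 with h | h
    · exact h.trans (le_max_left _ _)
    · exact h.trans (le_max_right _ _)
  set K := n + √(max B 0 / p) with hK
  -- The means of the truncations stay bounded: a mean far below -n would give the event Y ≥ -n, of
  -- fixed probability p > 0, too large a contribution to the variance.
  have hmK (M : ℕ) : -K ≤ m M := by
    by_contra! hlt
    have hlt' : √(max B 0 / p) < -n - m M := by linarith
    have hsq : max B 0 / p < (-n - m M) ^ 2 := (Real.sqrt_lt' (lt_of_le_of_lt (Real.sqrt_nonneg _) hlt')).1 hlt'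
    rw [div_lt_iff₀ hn] at hsq
    have hint : Integrable (fun ω => (max (Y ω) (-(M : ℝ)) - m M) ^ 2) P := by
      have h2 : MemLp (fun ω => max (Y ω) (-(M : ℝ)) - m M) 2 P :=
        (MemLp.of_bound (hYM M).aestronglyMeasurable M (Filter.Eventually.of_forall (hbd M))).sub
          (memLp_const _)
      exact h2.integrable_sq
    have : (-n - m M) ^ 2 * p ≤ ∫ ω, (max (Y ω) (-(M : ℝ)) - m M) ^ 2 ∂P := by
      rw [mul_comm, ← smul_eq_mul, hp, ← integral_indicator_const _ hms]
      refine integral_mono ((integrable_const _).indicator hms) hint fun ω => ?_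
      by_cases hω : ω ∈ {ω | -(n : ℝ) ≤ Y ω}
      · rw [Set.indicator_of_mem hω]
        have h1 : -(n : ℝ) ≤ max (Y ω) (-(M : ℝ)) := le_max_of_le_left hω
        have h0 : 0 ≤ -n - m M := le_trans (Real.sqrt_nonneg _) hlt'.le
        exact pow_le_pow_left₀ h0 (by linarith) 2
      · rw [Set.indicator_of_notMem hω]
        exact sq_nonneg _
    linarith [hB' M]
  -- Along a subsequence the means converge to some a, and Fatou's lemma bounds E (Y - a)².
  obtain ⟨a, -, φ, hφ, ha⟩ := isCompact_Icc.tendsto_subseq (x := m) (s := Set.Icc (-K) 0)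
    fun M => ⟨hmK M, hm0 M⟩
  refine (evariance_le_lintegral_sub hY a).trans ?_
  have hlim (ω : Ω) : Filter.Tendsto
      (fun k => ENNReal.ofReal ((max (Y ω) (-(φ k : ℝ)) - m (φ k)) ^ 2)) Filter.atTop
      (nhds (ENNReal.ofReal ((Y ω - a) ^ 2))) := by
    refine (ENNReal.continuous_ofReal.tendsto _).comp (Filter.Tendsto.pow (Filter.Tendsto.sub ?_ ha) 2)
    obtain ⟨k, hk⟩ := exists_nat_ge (-(Y ω))
    refine tendsto_const_nhds.congr' ?_
    filter_upwards [Filter.eventually_ge_atTop k] with j hj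
    have h1 : (k : ℝ) ≤ φ j := by exact_mod_cast hj.trans (hφ.id_le j)
    exact (max_eq_left (by linarith)).symm
  calc ∫⁻ ω, ENNReal.ofReal ((Y ω - a) ^ 2) ∂P
      = ∫⁻ ω, Filter.liminf
          (fun k => ENNReal.ofReal ((max (Y ω) (-(φ k : ℝ)) - m (φ k)) ^ 2)) Filter.atTop ∂P :=
        lintegral_congr fun ω => (hlim ω).liminf_eq.symm
    _ ≤ Filter.liminf (fun k => ∫⁻ ω,
          ENNReal.ofReal ((max (Y ω) (-(φ k : ℝ)) - m (φ k)) ^ 2) ∂P) Filter.atTop :=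
        lintegral_liminf_le fun k =>
          (((hYM (φ k)).sub_const _).pow_const 2).ennreal_ofReal
    _ ≤ ENNReal.ofReal B := by
        refine Filter.liminf_le_of_le (by isBoundedDefault) fun b hb => ?_
        obtain ⟨k, hk⟩ := hb.exists
        refine hk.trans ?_
        have := hB (φ k)
        rwa [evariance_eq_lintegral_ofReal] at this

end Truncation

/-! ### The upper bound on the varentropy. -/

section UpperBound

variable {G : Type*} [Group G] [TopologicalSpace G] [DiscreteTopology G]

theorem varentBound_nonneg {s : ℝ} (hs : 0 ≤ s) : 0 ≤ varentBound s :=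
  mul_nonneg hs (sq_nonneg _)

theorem sum_heatKernel_mul_sq_log_sub_le {μ : G →₀ ℝ≥0} (hμ : ∀ x z : G, μ (x * z * x⁻¹) = μ z)
    (hsymm : ∀ z : G, μ z⁻¹ = μ z) {e : G} {r : ℝ≥0} (hr : r ≤ μ e) {t : ℝ≥0}
    (hs : 0 < (r * t : ℝ)) (F : Finset G) :
    r * t * ∑ x ∈ F, heatKernel μ t x *
        (Real.log (heatKernel μ t (x * e)) - Real.log (heatKernel μ t x)) ^ 2 ≤
      16 * varentBound (r * t) := by
  obtain ⟨hpos, h1⟩ := heatKernel_mul_right_pos_and_sum_le hμ hr hs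
  obtain ⟨-, h2⟩ := heatKernel_mul_right_pos_and_sum_le hμ (e := e⁻¹) (by rwa [hsymm]) hs
  have h2' := h2 (F.map (mulRightEmbedding e))
  simp only [Finset.sum_map, mulRightEmbedding_apply, mul_inv_cancel_right] at h2'
  have hV := sq_log_le_varentBound hs
  have key : ∑ x ∈ F, heatKernel μ t x *
        (Real.log (heatKernel μ t (x * e)) - Real.log (heatKernel μ t x)) ^ 2 ≤
      4 * Real.log (1 + √((r * t : ℝ) + 1) / (r * t)) ^ 2 := by
    refine le_trans ?_ (le_of_le_of_eq (add_le_add (h1 F) h2') (by ring))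
    rw [← Finset.sum_add_distrib]
    refine Finset.sum_le_sum fun x _ => ?_
    set q := heatKernel μ t x
    set q' := heatKernel μ t (x * e)
    have hq : 0 ≤ q := heatKernel_nonneg μ t x
    have hq' : 0 ≤ q' := heatKernel_nonneg μ t (x * e)
    rcases hq.eq_or_lt with h | h
    · rw [← h, zero_mul, zero_mul, zero_add]
      positivity
    -- This excludes the default value `Real.log 0 = 0` at the neighbouring point.
    have h' : 0 < q' := hpos x h
    rcases le_total (Real.log q') (Real.log q) with hl | hl
    · rw [max_eq_right (sub_nonneg.2 hl), max_eq_left (sub_nonpos.2 hl)]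
      nlinarith
    · rw [max_eq_left (sub_nonpos.2 hl), max_eq_right (sub_nonneg.2 hl)]
      -- The bound for e⁻¹ weights the increments by q' instead of q, and q' is the larger exactly
      -- in this case.
      have : q ≤ q' := (Real.log_le_log_iff h h').1 hl
      nlinarith [sq_nonneg (Real.log q' - Real.log q)]
  nlinarith [mul_le_mul_of_nonneg_left key hs.le]

/-- The truncation `max (log f) (-M)` of the logarithm of the heat kernel. -/
def truncatedLogHeatKernel (μ : G →₀ ℝ≥0) (t : ℝ≥0) (M : ℕ) : G →ᵇ ℝ :=
  BoundedContinuousFunction.ofNormedAddCommGroupDiscrete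
    (fun x => max (Real.log (heatKernel μ t x)) (-M)) M fun x => by
      rw [Real.norm_eq_abs, abs_le]
      refine ⟨le_max_right _ _, max_le ?_ (by linarith [Nat.cast_nonneg (α := ℝ) M])⟩
      exact (Real.log_nonpos (heatKernel_nonneg μ t x) (heatKernel_le_one μ t x)).trans
        (Nat.cast_nonneg M)

theorem truncatedLogHeatKernel_apply (μ : G →₀ ℝ≥0) (t : ℝ≥0) (M : ℕ) (x : G) :
    truncatedLogHeatKernel μ t M x = max (Real.log (heatKernel μ t x)) (-M) := rfl

variable {Ω : Type*} [MeasurableSpace Ω] {P : Measure Ω} [IsProbabilityMeasure P]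

theorem HasWalkLaw.integral_sq_truncated_le {μ : G →₀ ℝ≥0} {t : ℝ≥0} {Y : Ω → G}
    (hY : HasWalkLaw μ t P Y) (hμ : ∀ x z : G, μ (x * z * x⁻¹) = μ z)
    (hsymm : ∀ z : G, μ z⁻¹ = μ z) {e : G} {r : ℝ≥0} (hr : r ≤ μ e) (M : ℕ) :
    r * t * ∫ ω, (truncatedLogHeatKernel μ t M (Y ω * e) -
      truncatedLogHeatKernel μ t M (Y ω)) ^ 2 ∂P ≤ 16 * varentBound (r * t) := by
  have hrt : (0 : ℝ) ≤ r * t := by positivity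
  rcases hrt.eq_or_lt with h | hs
  · rw [← h, zero_mul]
    exact mul_nonneg (by norm_num) (varentBound_nonneg le_rfl)
  rw [← le_div_iff₀' hs]
  have hV := varentBound_nonneg hrt
  rw [← ENNReal.ofReal_le_ofReal_iff (by positivity)]
  set f := truncatedLogHeatKernel μ t M with hf
  have hint : Integrable (fun ω => (f (Y ω * e) - f (Y ω)) ^ 2) P := by
    refine Integrable.of_bound
      (hY.measurable_comp fun y => (f (y * e) - f y) ^ 2).aestronglyMeasurable
      ((2 * ‖f‖) ^ 2) (Filter.Eventually.of_forall fun ω => ?_)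
    rw [norm_pow]
    refine pow_le_pow_left₀ (norm_nonneg _) ?_ 2
    exact (norm_sub_le _ _).trans (by linarith [f.norm_coe_le_norm (Y ω * e), f.norm_coe_le_norm (Y ω)])
  rw [ofReal_integral_eq_lintegral_ofReal hint (Filter.Eventually.of_forall fun _ => sq_nonneg _)]
  refine hY.lintegral_le (h := fun x => ENNReal.ofReal ((f (x * e) - f x) ^ 2)) fun F => ?_
  simp only [← ENNReal.ofReal_mul (sq_nonneg _)]
  rw [← ENNReal.ofReal_sum_of_nonneg fun x _ => mul_nonneg (sq_nonneg _) (heatKernel_nonneg μ t x)]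
  refine ENNReal.ofReal_le_ofReal ?_
  rw [le_div_iff₀' hs]
  refine le_trans ?_ (sum_heatKernel_mul_sq_log_sub_le hμ hsymm hr hs F)
  refine mul_le_mul_of_nonneg_left (Finset.sum_le_sum fun x _ => ?_) hrt
  rw [mul_comm]
  refine mul_le_mul_of_nonneg_left ?_ (heatKernel_nonneg μ t x)
  rw [hf, truncatedLogHeatKernel_apply, truncatedLogHeatKernel_apply]
  exact sq_le_sq.2 (abs_max_sub_max_le_abs _ _ _)

/-- Comparing finitely supported functions, not sets of jumps, accommodates repetitions among the
e_i and involutions. -/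
theorem sum_mul_eq_sum_generatorMeasure {μ : G →₀ ℝ≥0} {d : ℕ} {e : Fin d → G}
    {rate : Fin d → ℝ≥0} (h : μ.erase 1 = generatorMeasure e rate) {I : G → ℝ} (hI : I 1 = 0) :
    ∑ z ∈ μ.support, (μ z : ℝ) * I z = ∑ i, (rate i * I (e i) + rate i * I (e i)⁻¹) := by
  have h0 : ∀ z : G, ((0 : ℝ≥0) : ℝ) * I z = 0 := by simp
  have hadd : ∀ (z : G) (a b : ℝ≥0), ((a + b : ℝ≥0) : ℝ) * I z = a * I z + b * I z := by
    intro z a b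
    push_cast
    ring
  have h1 : ∑ z ∈ μ.support, (μ z : ℝ) * I z = (μ.erase 1).sum fun z r => (r : ℝ) * I z := by
    have := Finsupp.sum_add_index' (f := Finsupp.single 1 (μ 1)) (g := μ.erase 1)
      (h := fun z (r : ℝ≥0) => (r : ℝ) * I z) h0 hadd
    rw [Finsupp.single_add_erase, Finsupp.sum_single_index (h0 1), hI, mul_zero, zero_add] at this
    exact this
  rw [h1, h, generatorMeasure, ← Finsupp.sum_finsetSum_index h0 hadd]
  refine Finset.sum_congr rfl fun i _ => ?_
  rw [Finsupp.sum_add_index' h0 hadd, Finsupp.sum_single_index (h0 _),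
    Finsupp.sum_single_index (h0 _)]

theorem rate_le_of_erase_eq {μ : G →₀ ℝ≥0} {d : ℕ} {e : Fin d → G}
    {rate : Fin d → ℝ≥0} (hrate : ∀ i, 0 < rate i) (h : μ.erase 1 = generatorMeasure e rate)
    (i : Fin d) : rate i ≤ μ (e i) := by
  classical
  have hle : rate i ≤ μ.erase 1 (e i) := by
    rw [h, generatorMeasure, Finsupp.finsetSum_apply]
    refine le_trans ?_ (Finset.single_le_sum (fun _ _ => zero_le) (Finset.mem_univ i))
    simp
  rcases eq_or_ne (e i) 1 with h1 | h1
  · rw [h1, Finsupp.erase_same] at hle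
    exact absurd (hrate i) hle.not_gt
  · rwa [Finsupp.erase_ne h1] at hle

theorem HasWalkLaw.varent_le {μ : G →₀ ℝ≥0} {t : ℝ≥0} {Y : Ω → G}
    (hY : HasWalkLaw μ t P Y) (hμ : ∀ x z : G, μ (x * z * x⁻¹) = μ z)
    (hsymm : ∀ z : G, μ z⁻¹ = μ z) {d : ℕ} {e : Fin d → G} {rate : Fin d → ℝ≥0}
    (hrate : ∀ i, 0 < rate i) (h : μ.erase 1 = generatorMeasure e rate) :
    varent P Y ≤ ENNReal.ofReal (32 * ∑ i, varentBound (rate i * t)) := by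
  have hv : varent P Y = evariance (fun ω => Real.log (heatKernel μ t (Y ω))) P := by
    simp only [varent, hY.real_preimage_singleton]
  rw [hv]
  refine evariance_le_of_forall_truncation
    (hY.measurable_comp fun x => Real.log (heatKernel μ t x))
    (fun ω => Real.log_nonpos (heatKernel_nonneg μ t _) (heatKernel_le_one μ t _)) fun M => ?_
  refine (hY.evariance_comp_le hμ (truncatedLogHeatKernel μ t M)).trans
    (ENNReal.ofReal_le_ofReal ?_)
  rw [sum_mul_eq_sum_generatorMeasure h (by simp), Finset.mul_sum, Finset.mul_sum]
  refine Finset.sum_le_sum fun i _ => ?_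
  have hi := rate_le_of_erase_eq hrate h i
  -- The jumps e_i and e_i⁻¹ contribute 16 V(μ_i t) each, whence the constant 32.
  have h1 := hY.integral_sq_truncated_le hμ hsymm hi M
  have h2 := hY.integral_sq_truncated_le hμ hsymm (e := (e i)⁻¹) (r := rate i) (by rwa [hsymm]) M
  linarith

end UpperBound

/-! ### Trinomial coefficients. -/

section Trinomial

/-- The coefficient of `x ^ k` in the Laurent polynomial `(x + 1 + x⁻¹) ^ n`. -/
def trinomialCoeff : ℕ → ℤ → ℝ
  | 0, k => if k = 0 then 1 else 0
  | n + 1, k => trinomialCoeff n (k - 1) + trinomialCoeff n k + trinomialCoeff n (k + 1)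

theorem trinomialCoeff_zero (k : ℤ) : trinomialCoeff 0 k = if k = 0 then 1 else 0 := rfl

theorem trinomialCoeff_succ (n : ℕ) (k : ℤ) : trinomialCoeff (n + 1) k =
    trinomialCoeff n (k - 1) + trinomialCoeff n k + trinomialCoeff n (k + 1) := rfl

theorem trinomialCoeff_nonneg (n : ℕ) (k : ℤ) : 0 ≤ trinomialCoeff n k := by
  induction n generalizing k with
  | zero => rw [trinomialCoeff_zero]; split_ifs <;> norm_num
  | succ n ih => rw [trinomialCoeff_succ]; linarith [ih (k - 1), ih k, ih (k + 1)]

theorem trinomialCoeff_neg (n : ℕ) (k : ℤ) : trinomialCoeff n (-k) = trinomialCoeff n k := by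
  induction n generalizing k with
  | zero => simp [trinomialCoeff_zero]
  | succ n ih =>
    rw [trinomialCoeff_succ, trinomialCoeff_succ, show -k - 1 = -(k + 1) by ring,
      show -k + 1 = -(k - 1) by ring, ih, ih, ih]
    ring

/-- The difference of neighbours at level n + 1 telescopes to the values at k - 1 and k + 2 at level
n. The middle term of x + 1 + x⁻¹ avoids the parity zeros of (x + x⁻¹)^n, which would destroy
monotonicity. -/
theorem trinomialCoeff_antitone (n : ℕ) {k : ℤ} (hk : 0 ≤ k) :
    trinomialCoeff n (k + 1) ≤ trinomialCoeff n k := by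
  induction n generalizing k with
  | zero =>
    rw [trinomialCoeff_zero, trinomialCoeff_zero, if_neg (by omega)]
    split_ifs <;> norm_num
  | succ n ih =>
    rw [trinomialCoeff_succ, trinomialCoeff_succ, add_sub_cancel_right]
    have h1 : trinomialCoeff n (k + 1 + 1) ≤ trinomialCoeff n (k + 1) := ih (by omega)
    have h2 : trinomialCoeff n (k + 1) ≤ trinomialCoeff n (k - 1) := by
      rcases hk.eq_or_lt with rfl | h
      · rw [← trinomialCoeff_neg]
        norm_num
      · have := ih (k := k - 1) (by omega)
        rw [sub_add_cancel] at this
        exact (ih hk).trans this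
    linarith

/-- Compare coefficients after applying x d/dx to (x + 1 + x⁻¹)^(n+1). -/
theorem mul_trinomialCoeff_succ (n : ℕ) (k : ℤ) : k * trinomialCoeff (n + 1) k =
    (n + 1) * (trinomialCoeff n (k - 1) - trinomialCoeff n (k + 1)) := by
  induction n generalizing k with
  | zero =>
    rw [trinomialCoeff_succ]
    simp only [trinomialCoeff_zero]
    rcases lt_trichotomy k 0 with h | rfl | h
    · by_cases h1 : k = -1
      · subst h1; norm_num
      · simp [h.ne, show k - 1 ≠ 0 by omega, show k + 1 ≠ 0 by omega]
    · norm_num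
    · by_cases h1 : k = 1
      · subst h1; norm_num
      · simp [h.ne', show k - 1 ≠ 0 by omega, show k + 1 ≠ 0 by omega]
  | succ n ih =>
    have h1 := ih (k - 1)
    have h2 := ih k
    have h3 := ih (k + 1)
    have e1 := trinomialCoeff_succ n (k - 1)
    have e3 := trinomialCoeff_succ n (k + 1)
    rw [sub_add_cancel] at h1 e1
    rw [add_sub_cancel_right] at h3 e3
    rw [trinomialCoeff_succ]
    push_cast at h1 h2 h3 ⊢
    linear_combination h1 + h2 + h3 - (n + 1) * e1 + (n + 1) * e3

theorem one_le_trinomialCoeff (n : ℕ) : 1 ≤ trinomialCoeff n 0 := by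
  induction n with
  | zero => simp [trinomialCoeff_zero]
  | succ n ih =>
    rw [trinomialCoeff_succ]
    linarith [trinomialCoeff_nonneg n (0 - 1), trinomialCoeff_nonneg n (0 + 1)]

theorem hasSum_trinomialCoeff (n : ℕ) : HasSum (trinomialCoeff n) (3 ^ n) := by
  induction n with
  | zero =>
    have h := hasSum_single (f := trinomialCoeff 0) 0 fun k hk => by
      rw [trinomialCoeff_zero, if_neg hk]
    simpa [trinomialCoeff_zero] using h
  | succ n ih =>
    have h1 : HasSum (fun k => trinomialCoeff n (k - 1)) (3 ^ n) :=
      (Equiv.subRight (1 : ℤ)).hasSum_iff.2 ih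
    have h3 : HasSum (fun k => trinomialCoeff n (k + 1)) (3 ^ n) :=
      (Equiv.addRight (1 : ℤ)).hasSum_iff.2 ih
    rw [show (3 : ℝ) ^ (n + 1) = 3 ^ n + 3 ^ n + 3 ^ n by ring]
    exact (h1.add ih).add h3

theorem trinomialCoeff_le (n : ℕ) (k : ℤ) : trinomialCoeff n k ≤ 3 ^ n :=
  le_hasSum (hasSum_trinomialCoeff n) k fun j _ => trinomialCoeff_nonneg n j

end Trinomial

/-! ### The kernel of the walk on ℤ as a Poisson mixture of trinomial coefficients. -/

section WalkKernel

/-- The transition probabilities at time `s` of the simple random walk on `ℤ` which jumps in each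
direction at rate one. -/
def walkKernel (s : ℝ) (k : ℤ) : ℝ :=
  ∑' n : ℕ, Real.exp (-(3 * s)) * s ^ n / n.factorial * trinomialCoeff n k

variable {s : ℝ}

theorem hasSum_exp_three (s : ℝ) :
    HasSum (fun n : ℕ => Real.exp (-(3 * s)) * s ^ n / n.factorial * 3 ^ n) 1 := by
  convert hasSum_poisson (3 * s) using 2
  rw [mul_pow]
  ring

theorem hasSum_walkKernel (hs : 0 ≤ s) (k : ℤ) :
    HasSum (fun n : ℕ => Real.exp (-(3 * s)) * s ^ n / n.factorial * trinomialCoeff n k)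
      (walkKernel s k) := by
  refine Summable.hasSum (Summable.of_nonneg_of_le (fun n => ?_) (fun n => ?_)
    (hasSum_exp_three s).summable)
  · have := trinomialCoeff_nonneg n k
    positivity
  · exact mul_le_mul_of_nonneg_left (trinomialCoeff_le n k) (by positivity)

theorem walkKernel_nonneg (hs : 0 ≤ s) (k : ℤ) : 0 ≤ walkKernel s k :=
  (hasSum_walkKernel hs k).nonneg fun n => by
    have := trinomialCoeff_nonneg n k
    positivity

theorem walkKernel_neg (s : ℝ) (k : ℤ) : walkKernel s (-k) = walkKernel s k := by
  simp only [walkKernel, trinomialCoeff_neg]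

theorem walkKernel_succ_le (hs : 0 ≤ s) {k : ℤ} (hk : 0 ≤ k) :
    walkKernel s (k + 1) ≤ walkKernel s k :=
  hasSum_le (fun n => mul_le_mul_of_nonneg_left (trinomialCoeff_antitone n hk) (by positivity))
    (hasSum_walkKernel hs (k + 1)) (hasSum_walkKernel hs k)

/-- The recurrence of the modified Bessel functions, inherited from the trinomial coefficients by
summing over n; the term n = 0 vanishes. -/
theorem mul_walkKernel (hs : 0 ≤ s) (k : ℤ) :
    k * walkKernel s k = s * (walkKernel s (k - 1) - walkKernel s (k + 1)) := by
  have h1 := (hasSum_walkKernel hs k).mul_left (k : ℝ)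
  have h2 := ((hasSum_walkKernel hs (k - 1)).sub (hasSum_walkKernel hs (k + 1))).mul_left s
  rw [← hasSum_nat_add_iff' 1] at h1
  have h0 : (k : ℝ) * trinomialCoeff 0 k = 0 := by
    rw [trinomialCoeff_zero]
    split_ifs with h <;> simp [h]
  have e0 : ∑ i ∈ Finset.range 1, (k : ℝ) * (Real.exp (-(3 * s)) * s ^ i / i.factorial *
      trinomialCoeff i k) = 0 := by
    rw [Finset.sum_range_one]
    linear_combination (Real.exp (-(3 * s)) * s ^ 0 / (Nat.factorial 0)) * h0
  rw [e0, sub_zero] at h1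
  refine h1.unique ?_
  have e (n : ℕ) : (k : ℝ) * (Real.exp (-(3 * s)) * s ^ (n + 1) / (n + 1).factorial *
      trinomialCoeff (n + 1) k) = s * (Real.exp (-(3 * s)) * s ^ n / n.factorial *
        trinomialCoeff n (k - 1) - Real.exp (-(3 * s)) * s ^ n / n.factorial *
        trinomialCoeff n (k + 1)) := by
    have h := mul_trinomialCoeff_succ n k
    have hn : (n.factorial : ℝ) ≠ 0 := by positivity
    rw [mul_left_comm, h, Nat.factorial_succ]
    push_cast
    field_simp
    ring
  simp only [e]
  exact h2

theorem exp_le_walkKernel_zero (hs : 0 ≤ s) : Real.exp (-(2 * s)) ≤ walkKernel s 0 := by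
  have h := (hasSum_poisson s).mul_left (Real.exp (-(2 * s)))
  rw [mul_one] at h
  refine hasSum_le (fun n => ?_) h (hasSum_walkKernel hs 0)
  calc _ = Real.exp (-(3 * s)) * s ^ n / n.factorial * 1 := by
        rw [show -(3 * s) = -(2 * s) + -s by ring, Real.exp_add]
        ring
    _ ≤ _ := mul_le_mul_of_nonneg_left (one_le_trinomialCoeff n) (by positivity)

theorem summable_trinomialCoeff_mixture {w : ℕ → ℝ} (hw : ∀ n, 0 ≤ w n)
    (hsum : Summable fun n => w n * 3 ^ n) {g : ℤ → ℝ} {C : ℝ} (hg : ∀ k, ‖g k‖ ≤ C) :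
    Summable (fun x : ℕ × ℤ => w x.1 * (trinomialCoeff x.1 x.2 * g x.2)) := by
  have hb : Summable (fun x : ℕ × ℤ => w x.1 * trinomialCoeff x.1 x.2) := by
    have hnn : 0 ≤ fun x : ℕ × ℤ => w x.1 * trinomialCoeff x.1 x.2 :=
      fun x => mul_nonneg (hw _) (trinomialCoeff_nonneg _ _)
    refine (summable_prod_of_nonneg hnn).2 ⟨fun n => ?_, ?_⟩
    · exact (hasSum_trinomialCoeff n).summable.mul_left (w n)
    · have e (n : ℕ) : ∑' k, w n * trinomialCoeff n k = w n * 3 ^ n :=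
        ((hasSum_trinomialCoeff n).mul_left (w n)).tsum_eq
      simp only [e]
      exact hsum
  refine Summable.of_norm_bounded (hb.mul_right C) fun x => ?_
  have h0 : 0 ≤ w x.1 * trinomialCoeff x.1 x.2 := mul_nonneg (hw _) (trinomialCoeff_nonneg _ _)
  rw [← mul_assoc, norm_mul, Real.norm_of_nonneg h0]
  exact mul_le_mul_of_nonneg_left (hg _) h0

/-- Fubini for the double sum over the number n of steps and the position k. -/
theorem hasSum_walkKernel_mul (hs : 0 ≤ s) {g : ℤ → ℝ} {C : ℝ} (hg : ∀ k, ‖g k‖ ≤ C) {b : ℕ → ℝ}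
    {v : ℝ} (hb : ∀ n, HasSum (fun k => trinomialCoeff n k * g k) (b n))
    (hv : HasSum (fun n : ℕ => Real.exp (-(3 * s)) * s ^ n / n.factorial * b n) v) :
    HasSum (fun k => walkKernel s k * g k) v := by
  obtain ⟨w, hw⟩ : ∃ w : ℕ → ℝ, ∀ n, Real.exp (-(3 * s)) * s ^ n / n.factorial = w n :=
    ⟨_, fun _ => rfl⟩
  have hk := hasSum_walkKernel hs
  have h3 := (hasSum_exp_three s).summable
  have hnn (n : ℕ) : 0 ≤ w n := by
    rw [← hw]
    positivity
  simp only [hw] at hv hk h3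
  obtain ⟨a, ha⟩ := summable_trinomialCoeff_mixture hnn h3 hg
  have h2 : HasSum (fun n => w n * b n) a := ha.prod_fiberwise fun n => (hb n).mul_left (w n)
  rw [hv.unique h2]
  have ha' : HasSum (fun x : ℤ × ℕ => w x.2 * (trinomialCoeff x.2 x.1 * g x.1)) a :=
    (Equiv.prodComm ℤ ℕ).hasSum_iff.2 ha
  refine ha'.prod_fiberwise fun k => ?_
  have h4 := (hk k).mul_right (g k)
  simp only [mul_assoc] at h4
  exact h4

end WalkKernel

/-! ### The semigroup of the jumps along u and u⁻¹. -/

section WalkOnCyclic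

variable {G : Type*} [Group G] [TopologicalSpace G] [DiscreteTopology G]

theorem hasSum_trinomialCoeff_mul (u : G) (n : ℕ) (f : G →ᵇ ℝ) (y : G) :
    HasSum (fun k : ℤ => trinomialCoeff n k * f (y * u ^ k))
      (((translation u + 1 + translation u⁻¹) ^ n) f y) := by
  induction n generalizing y with
  | zero =>
    convert hasSum_single (f := fun k : ℤ => trinomialCoeff 0 k * f (y * u ^ k)) 0 ?_ using 1
    · simp [trinomialCoeff_zero]
    · intro k hk
      rw [trinomialCoeff_zero, if_neg hk, zero_mul]
  | succ n ih =>
    have h1 : HasSum (fun k : ℤ => trinomialCoeff n (k - 1) * f (y * u ^ k))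
        (((translation u + 1 + translation u⁻¹) ^ n) f (y * u)) := by
      rw [← (Equiv.addRight (1 : ℤ)).hasSum_iff]
      convert ih (y * u) using 2 with k
      simp [zpow_add, mul_assoc, (Commute.refl u).zpow_left k |>.eq]
    have h3 : HasSum (fun k : ℤ => trinomialCoeff n (k + 1) * f (y * u ^ k))
        (((translation u + 1 + translation u⁻¹) ^ n) f (y * u⁻¹)) := by
      rw [← (Equiv.subRight (1 : ℤ)).hasSum_iff]
      convert ih (y * u⁻¹) using 2 with k
      simp [zpow_sub, mul_assoc, (Commute.refl u).inv_left.zpow_right k |>.eq]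
    convert (h1.add (ih y)).add h3 using 1
    · ext k
      rw [trinomialCoeff_succ]
      ring
    · rw [pow_succ']
      rfl

theorem hasSum_walkSemigroup_pair (u : G) (r t : ℝ≥0) (f : G →ᵇ ℝ) (y : G) :
    HasSum (fun k : ℤ => walkKernel (r * t) k * f (y * u ^ k))
      (walkSemigroup (Finsupp.single u r + Finsupp.single u⁻¹ r) t f y) := by
  set s : ℝ := r * t with hs
  have hs0 : 0 ≤ s := by positivity
  have hgen : walkGenerator (Finsupp.single u r + Finsupp.single u⁻¹ r) =
      (r : ℝ) • ((translation u + 1 + translation u⁻¹) -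
        (3 : ℝ) • (1 : (G →ᵇ ℝ) →L[ℝ] (G →ᵇ ℝ))) := by
    rw [walkGenerator_add, walkGenerator_single, walkGenerator_single]
    module
  have h1 : HasSum (fun n : ℕ => Real.exp (-(3 * s)) * s ^ n / n.factorial *
      ((translation u + 1 + translation u⁻¹) ^ n) f y)
      (walkSemigroup (Finsupp.single u r + Finsupp.single u⁻¹ r) t f y) := by
    rw [walkSemigroup, hgen, operatorSemigroup_smul, operatorSemigroup_sub_smul_one]
    have h := (hasSum_operatorSemigroup_apply_apply
      (translation u + 1 + translation u⁻¹) (r * t) f y).mul_left (Real.exp (-(3 * s)))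
    have e (n : ℕ) : Real.exp (-(3 * s)) * s ^ n / n.factorial *
        ((translation u + 1 + translation u⁻¹) ^ n) f y =
        Real.exp (-(3 * s)) * ((n.factorial : ℝ)⁻¹ * ((r * t : ℝ≥0) : ℝ) ^ n *
          ((translation u + 1 + translation u⁻¹) ^ n) f y) := by
      push_cast
      ring
    simp only [e]
    exact h
  exact hasSum_walkKernel_mul hs0 (fun k => f.norm_coe_le_norm _)
    (fun n => hasSum_trinomialCoeff_mul u n f y) h1

theorem hasSum_walkKernel_one {s : ℝ} (hs : 0 ≤ s) : HasSum (walkKernel s) 1 := by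
  -- Group and element are immaterial: the total mass is read off from a constant function, which
  -- the semigroup fixes.
  have h := hasSum_walkSemigroup_pair (1 : Multiplicative ℤ) ⟨s, hs⟩ 1
    (BoundedContinuousFunction.const _ 1) 1
  rw [walkSemigroup_const] at h
  simp only [BoundedContinuousFunction.const_apply, mul_one, NNReal.coe_one] at h
  exact h

end WalkOnCyclic

/-! ### Product form of the heat kernel on ℤ^d. -/

section Lattice

theorem walkGenerator_comm {G : Type*} [CommGroup G] [TopologicalSpace G] [DiscreteTopology G]
    (μ ν : G →₀ ℝ≥0) (f : G →ᵇ ℝ) :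
    walkGenerator μ (walkGenerator ν f) = walkGenerator ν (walkGenerator μ f) := by
  have h (z : G) (g : G →ᵇ ℝ) :
      walkGenerator μ (translation z g) = translation z (walkGenerator μ g) :=
    walkGenerator_translation (fun x z => by rw [mul_comm x z, mul_inv_cancel_right]) z g
  rw [walkGenerator_eq_sum ν]
  simp only [Finsupp.sum, sum_apply, smul_apply, sub_apply, map_sum, map_smul, map_sub, h]
  rfl

variable {d : ℕ}

/-- The semigroup of the coordinates in `S` applied to the indicator function of a point. -/
theorem walkSemigroup_sum_pairs_apply (rate : Fin d → ℝ≥0) (t : ℝ≥0) (x : Fin d → ℤ)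
    (S : Finset (Fin d)) (y : Multiplicative (Fin d → ℤ)) :
    walkSemigroup (∑ i ∈ S, (Finsupp.single (unitVector i) (rate i) +
        Finsupp.single (unitVector i)⁻¹ (rate i))) t (setIndicator {Multiplicative.ofAdd x}) y =
      ∏ i, (if i ∈ S then walkKernel (rate i * t) (x i - y.toAdd i) else
        if x i = y.toAdd i then 1 else 0) := by
  classical
  induction S using Finset.induction_on generalizing y with
  | empty =>
    have h0 : walkSemigroup (0 : Multiplicative (Fin d → ℤ) →₀ ℝ≥0) t
        (setIndicator {Multiplicative.ofAdd x}) = setIndicator {Multiplicative.ofAdd x} :=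
      walkSemigroup_apply_of_invariant _ _ (by simp)
    rw [Finset.sum_empty, h0, setIndicator_apply]
    simp only [Finset.notMem_empty, if_false, Set.mem_singleton_iff]
    rw [Finset.prod_ite_zero, Finset.prod_const_one]
    have hiff : y = Multiplicative.ofAdd x ↔ ∀ i ∈ Finset.univ, x i = y.toAdd i := by
      constructor
      · rintro rfl i _
        rfl
      · intro h
        exact Multiplicative.toAdd.injective (funext fun i => (h i (Finset.mem_univ i)).symm)
    by_cases h : y = Multiplicative.ofAdd x
    · rw [if_pos h, if_pos (hiff.1 h)]
    · rw [if_neg h, if_neg (mt hiff.2 h)]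
  | insert j S hj ih =>
    rw [Finset.sum_insert hj, walkSemigroup_add_apply (walkGenerator_comm _ _)]
    refine (hasSum_walkSemigroup_pair (unitVector j) (rate j) t _ y).unique ?_
    simp only [ih]
    have hy (k : ℤ) (i : Fin d) : (y * unitVector j ^ k).toAdd i =
        y.toAdd i + if i = j then k else 0 := by
      simp [unitVector, Pi.single_apply]
    -- Moving along coordinate j alters only the j-th factor, still an indicator, which selects the
    -- single term k = x_j - y_j.
    have hterm (k : ℤ) : ∏ i, (if i ∈ S then walkKernel (rate i * t)
          (x i - (y * unitVector j ^ k).toAdd i) else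
          if x i = (y * unitVector j ^ k).toAdd i then 1 else 0) =
        (if x j = y.toAdd j + k then 1 else 0) *
          ∏ i ∈ Finset.univ.erase j, (if i ∈ S then walkKernel (rate i * t) (x i - y.toAdd i) else
            if x i = y.toAdd i then 1 else 0) := by
      rw [← Finset.mul_prod_erase _ _ (Finset.mem_univ j), if_neg hj, hy, if_pos rfl]
      congr 1
      refine Finset.prod_congr rfl fun i hi => ?_
      rw [hy, if_neg (Finset.ne_of_mem_erase hi), add_zero]
    simp only [hterm]
    have h := hasSum_single (f := fun k : ℤ => walkKernel (rate j * t) k *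
      ((if x j = y.toAdd j + k then 1 else 0) *
          ∏ i ∈ Finset.univ.erase j, (if i ∈ S then walkKernel (rate i * t) (x i - y.toAdd i) else
            if x i = y.toAdd i then 1 else 0))) (x j - y.toAdd j) (fun k hk => by
      rw [if_neg fun h => hk (by omega), zero_mul, mul_zero])
    convert h using 1
    rw [← Finset.mul_prod_erase _ _ (Finset.mem_univ j), if_pos (Finset.mem_insert_self j S),
      if_pos (by ring), one_mul]
    congr 1
    refine Finset.prod_congr rfl fun i hi => ?_
    simp only [Finset.mem_insert, Finset.ne_of_mem_erase hi, false_or]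

theorem heatKernel_generatorMeasure_unitVector (rate : Fin d → ℝ≥0) (t : ℝ≥0) (x : Fin d → ℤ) :
    heatKernel (generatorMeasure unitVector rate) t (Multiplicative.ofAdd x) =
      ∏ i, walkKernel (rate i * t) (x i) := by
  rw [heatKernel, generatorMeasure, walkSemigroup_sum_pairs_apply]
  simp

end Lattice

theorem HasSum.of_eq {ι : Type*} {f g : ι → ℝ} {a b : ℝ} (h : HasSum f a) (hfg : ∀ i, g i = f i)
    (hab : b = a) : HasSum g b := by
  rw [hab, show g = f from funext hfg]
  exact h

/-! ### Moments of the kernel on ℤ. -/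

section Moments

variable {s : ℝ}

theorem abs_mul_walkKernel_le (hs : 0 ≤ s) (k : ℤ) :
    |(k : ℝ)| * walkKernel s k ≤ s * (walkKernel s (k - 1) + walkKernel s (k + 1)) := by
  rw [← abs_of_nonneg (walkKernel_nonneg hs k), ← abs_mul, mul_walkKernel hs, abs_mul,
    abs_of_nonneg hs]
  refine mul_le_mul_of_nonneg_left ?_ hs
  rw [abs_le]
  constructor <;> linarith [walkKernel_nonneg hs (k - 1), walkKernel_nonneg hs (k + 1)]

/-- Induction on the moment: the recurrence trades a factor |k| for a shift by one, which changes 1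
+ |k| at most by a factor 2. -/
theorem summable_one_add_abs_pow_mul_walkKernel (hs : 0 ≤ s) (j : ℕ) :
    Summable fun k : ℤ => (1 + |(k : ℝ)|) ^ j * walkKernel s k := by
  induction j with
  | zero => simpa using (hasSum_walkKernel_one hs).summable
  | succ j ih =>
    have h1 : Summable fun k : ℤ => (1 + |((k - 1 : ℤ) : ℝ)|) ^ j * walkKernel s (k - 1) :=
      ((Equiv.subRight (1 : ℤ)).summable_iff
        (f := fun k : ℤ => (1 + |(k : ℝ)|) ^ j * walkKernel s k)).2 ih
    have h3 : Summable fun k : ℤ => (1 + |((k + 1 : ℤ) : ℝ)|) ^ j * walkKernel s (k + 1) :=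
      ((Equiv.addRight (1 : ℤ)).summable_iff
        (f := fun k : ℤ => (1 + |(k : ℝ)|) ^ j * walkKernel s k)).2 ih
    refine Summable.of_nonneg_of_le (fun k => ?_) (fun k => ?_)
      (ih.add (((h1.add h3).mul_left (2 ^ j)).mul_left s))
    · exact mul_nonneg (by positivity) (walkKernel_nonneg hs k)
    · have hk : (0 : ℝ) ≤ (1 + |(k : ℝ)|) ^ j := by positivity
      have hb (l : ℤ) (hl : |(k : ℝ) - l| ≤ 1) : (1 + |(k : ℝ)|) ^ j * walkKernel s l ≤
          2 ^ j * ((1 + |(l : ℝ)|) ^ j * walkKernel s l) := by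
        rw [← mul_assoc, ← mul_pow]
        refine mul_le_mul_of_nonneg_right (pow_le_pow_left₀ (by positivity) ?_ j)
          (walkKernel_nonneg hs l)
        have := abs_sub_abs_le_abs_sub (k : ℝ) l
        linarith [abs_nonneg (l : ℝ)]
      have hb1 := hb (k - 1) (by push_cast; norm_num)
      have hb3 := hb (k + 1) (by push_cast; norm_num)
      have hk' := mul_le_mul_of_nonneg_left (abs_mul_walkKernel_le hs k) hk
      have := mul_le_mul_of_nonneg_left (add_le_add hb1 hb3) hs
      rw [pow_succ]
      linarith

theorem summable_mul_walkKernel (hs : 0 ≤ s) {g : ℤ → ℝ} (j : ℕ) (C : ℝ)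
    (hg : ∀ k : ℤ, |g k| ≤ C * (1 + |(k : ℝ)|) ^ j) : Summable fun k => g k * walkKernel s k := by
  refine Summable.of_norm_bounded
    ((summable_one_add_abs_pow_mul_walkKernel hs j).mul_left C) fun k => ?_
  rw [norm_mul, Real.norm_eq_abs, Real.norm_of_nonneg (walkKernel_nonneg hs k), ← mul_assoc]
  exact mul_le_mul_of_nonneg_right (hg k) (walkKernel_nonneg hs k)

/-- Summation by parts for the walk kernel. -/
theorem hasSum_mul_walkKernel_by_parts (hs : 0 ≤ s) {g : ℤ → ℝ} {v : ℝ}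
    (h1 : Summable fun k => g (k + 1) * walkKernel s k)
    (h2 : Summable fun k => g (k - 1) * walkKernel s k)
    (hv : HasSum (fun k => (g (k + 1) - g (k - 1)) * walkKernel s k) v) :
    HasSum (fun k : ℤ => g k * k * walkKernel s k) (s * v) := by
  obtain ⟨a, ha⟩ := h1
  obtain ⟨b, hb⟩ := h2
  have hab : v = a - b := by
    refine hv.unique ?_
    simpa only [sub_mul] using ha.sub hb
  have ha' : HasSum (fun k => g k * walkKernel s (k - 1)) a := by
    rw [← (Equiv.addRight (1 : ℤ)).hasSum_iff]
    simpa [Function.comp_def] using ha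
  have hb' : HasSum (fun k => g k * walkKernel s (k + 1)) b := by
    rw [← (Equiv.subRight (1 : ℤ)).hasSum_iff]
    simpa [Function.comp_def] using hb
  have e (k : ℤ) : g k * k * walkKernel s k =
      s * (g k * walkKernel s (k - 1) - g k * walkKernel s (k + 1)) := by
    rw [mul_assoc, mul_walkKernel hs]
    ring
  simp only [e, hab]
  exact (ha'.sub hb').mul_left s

theorem abs_pow_add_le (a : ℝ) (ha : |a| ≤ 1) (j : ℕ) (k : ℤ) :
    |((k : ℝ) + a) ^ j| ≤ 1 * (1 + |(k : ℝ)|) ^ j := by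
  rw [one_mul, abs_pow]
  refine pow_le_pow_left₀ (abs_nonneg _) ?_ j
  linarith [abs_add_le (k : ℝ) a]

theorem summable_pow_mul_walkKernel (hs : 0 ≤ s) (a : ℝ) (ha : |a| ≤ 1) (j : ℕ) :
    Summable fun k : ℤ => ((k : ℝ) + a) ^ j * walkKernel s k :=
  summable_mul_walkKernel hs j 1 (abs_pow_add_le a ha j)

theorem hasSum_sq_mul_walkKernel (hs : 0 ≤ s) :
    HasSum (fun k : ℤ => (k : ℝ) ^ 2 * walkKernel s k) (2 * s) := by
  have h := hasSum_mul_walkKernel_by_parts hs (g := fun k => (k : ℝ)) (v := 2) ?_ ?_ ?_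
  · exact h.of_eq (fun k => by ring) (by ring)
  · simpa using summable_pow_mul_walkKernel hs 1 (by simp) 1
  · simpa [sub_eq_add_neg] using summable_pow_mul_walkKernel hs (-1) (by simp) 1
  · exact ((hasSum_walkKernel_one hs).mul_left 2).of_eq (fun k => by push_cast; ring) (by ring)

theorem hasSum_pow_four_mul_walkKernel (hs : 0 ≤ s) :
    HasSum (fun k : ℤ => (k : ℝ) ^ 4 * walkKernel s k) (12 * s ^ 2 + 2 * s) := by
  have h := hasSum_mul_walkKernel_by_parts hs (g := fun k => (k : ℝ) ^ 3) (v := 12 * s + 2) ?_ ?_ ?_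
  · exact h.of_eq (fun k => by ring) (by ring)
  · simpa using summable_pow_mul_walkKernel hs 1 (by simp) 3
  · simpa [sub_eq_add_neg] using summable_pow_mul_walkKernel hs (-1) (by simp) 3
  · exact (((hasSum_sq_mul_walkKernel hs).mul_left 6).add
      ((hasSum_walkKernel_one hs).mul_left 2)).of_eq (fun k => by push_cast; ring) (by ring)

end Moments

/-! ### Ratios of values of the kernel on ℤ. -/

section Ratios

variable {s : ℝ}

theorem walkKernel_antitone (hs : 0 ≤ s) {m n : ℕ} (h : m ≤ n) :
    walkKernel s n ≤ walkKernel s m :=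
  antitone_nat_of_succ_le (f := fun n : ℕ => walkKernel s n)
    (fun n => by push_cast; exact walkKernel_succ_le hs (by positivity)) h

theorem walkKernel_natAbs (s : ℝ) (k : ℤ) : walkKernel s k.natAbs = walkKernel s k := by
  rcases Int.natAbs_eq k with h | h
  · rw [← h]
  · conv_rhs => rw [h, walkKernel_neg]

theorem walkKernel_step (hs : 0 ≤ s) (n : ℕ) :
    ((n : ℝ) + 1) * walkKernel s (n + 1 : ℕ) = s * (walkKernel s n - walkKernel s (n + 2 : ℕ)) := by
  have h := mul_walkKernel hs ((n : ℤ) + 1)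
  rw [add_sub_cancel_right, add_assoc] at h
  push_cast at h ⊢
  exact h

theorem mul_walkKernel_le_succ (hs : 0 ≤ s) (n : ℕ) :
    s * walkKernel s n ≤ (s + n + 1) * walkKernel s (n + 1 : ℕ) := by
  have h := walkKernel_step hs n
  have h2 := walkKernel_antitone hs (Nat.le_succ (n + 1))
  nlinarith [mul_le_mul_of_nonneg_left h2 hs]

theorem walkKernel_pos (hs : 0 < s) (k : ℤ) : 0 < walkKernel s k := by
  rw [← walkKernel_natAbs]
  induction k.natAbs with
  | zero => exact lt_of_lt_of_le (Real.exp_pos _) (exp_le_walkKernel_zero hs.le)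
  | succ n ih =>
    have h := mul_walkKernel_le_succ hs.le n
    exact pos_of_mul_pos_right (lt_of_lt_of_le (mul_pos hs ih) h) (by positivity)

theorem walkKernel_le_one (hs : 0 ≤ s) (k : ℤ) : walkKernel s k ≤ 1 :=
  le_hasSum (hasSum_walkKernel_one hs) k fun j _ => walkKernel_nonneg hs j

/-- A crude bound, needed only for square integrability: each step costs at most log(1 + (n+1)/s) ≤
(n+1)/s. -/
theorem neg_log_walkKernel_le (hs : 0 < s) (k : ℤ) :
    -Real.log (walkKernel s k) ≤ 2 * s + (k : ℝ) ^ 2 / s := by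
  have key (n : ℕ) : -Real.log (walkKernel s n) ≤ 2 * s + (n : ℝ) ^ 2 / s := by
    induction n with
    | zero =>
      have := Real.log_le_log (Real.exp_pos _) (exp_le_walkKernel_zero hs.le)
      rw [Real.log_exp] at this
      simpa using by linarith
    | succ n ih =>
      have h := mul_walkKernel_le_succ hs.le n
      have hn := walkKernel_pos hs n
      have hn1 := walkKernel_pos hs (n + 1 : ℕ)
      have h1 : walkKernel s n ≤ (1 + (n + 1) / s) * walkKernel s (n + 1 : ℕ) := by
        rw [show 1 + ((n : ℝ) + 1) / s = (s + n + 1) / s by field_simp; ring, div_mul_eq_mul_div,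
          le_div_iff₀ hs]
        linarith
      have h2 := Real.log_le_log hn h1
      rw [Real.log_mul (by positivity) hn1.ne'] at h2
      have h3 := Real.log_le_sub_one_of_pos (x := 1 + ((n : ℝ) + 1) / s) (by positivity)
      have h4 : (n : ℝ) ^ 2 / s + (n + 1) / s ≤ ((n + 1 : ℕ) : ℝ) ^ 2 / s := by
        rw [← add_div]
        refine div_le_div_of_nonneg_right ?_ hs.le
        push_cast
        nlinarith [Nat.cast_nonneg (α := ℝ) n]
      linarith
  have h := key k.natAbs
  rw [walkKernel_natAbs] at h
  have e : ((k.natAbs : ℕ) : ℝ) ^ 2 = (k : ℝ) ^ 2 := by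
    rw [Nat.cast_natAbs, Int.cast_abs, sq_abs]
  rwa [e] at h

theorem walkKernel_two_step (hs : 0 < s) (n : ℕ) :
    (1 + (n + 1) / s) * walkKernel s (n + 2 : ℕ) ≤ walkKernel s n := by
  have h := walkKernel_step hs.le n
  have h2 := walkKernel_antitone hs.le (Nat.le_succ (n + 1))
  have h3 : walkKernel s n = walkKernel s (n + 2 : ℕ) + (n + 1) / s * walkKernel s (n + 1 : ℕ) := by
    field_simp
    linarith
  rw [h3, add_mul, one_mul]
  gcongr

/-- Each double step gains a factor at least 1 + (n+1)/s. With n and j of order √s the total gain is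
bounded away from 1. -/
theorem walkKernel_many_steps (hs : 0 < s) (n j : ℕ) :
    (1 + j * ((n + 1) / s)) * walkKernel s (n + 2 * j : ℕ) ≤ walkKernel s n := by
  induction j with
  | zero => simp
  | succ j ih =>
    refine le_trans ?_ ih
    have h := walkKernel_two_step hs (n + 2 * j)
    have h0 := walkKernel_pos hs (n + 2 * (j + 1) : ℕ)
    have hx : 0 ≤ ((n : ℝ) + 1) / s := by positivity
    have hx' : ((n : ℝ) + 1) / s ≤ ((n + 2 * j : ℕ) + 1) / s := by
      gcongr
      linarith [Nat.cast_nonneg (α := ℝ) j]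
    have h1 : (1 + ((n : ℝ) + 1) / s) * walkKernel s (n + 2 * (j + 1) : ℕ) ≤
        walkKernel s (n + 2 * j : ℕ) := by
      refine le_trans ?_ h
      exact mul_le_mul_of_nonneg_right (by linarith) h0.le
    refine le_trans ?_ (mul_le_mul_of_nonneg_left h1 (by positivity))
    rw [← mul_assoc]
    refine mul_le_mul_of_nonneg_right ?_ h0.le
    push_cast
    nlinarith [mul_nonneg (mul_nonneg (Nat.cast_nonneg (α := ℝ) j) hx) hx]

end Ratios

/-! ### The law on ℤ as a probability measure. -/

section WalkPMF

/-- The law at time `s` of the simple random walk on `ℤ`. -/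
def walkPMF (s : ℝ≥0) : PMF ℤ :=
  ⟨fun k => ENNReal.ofReal (walkKernel s k), by
    rw [ENNReal.summable.hasSum_iff, ← ENNReal.ofReal_tsum_of_nonneg
      (fun k => walkKernel_nonneg s.coe_nonneg k) (hasSum_walkKernel_one s.coe_nonneg).summable,
      (hasSum_walkKernel_one s.coe_nonneg).tsum_eq, ENNReal.ofReal_one]⟩

theorem walkPMF_apply (s : ℝ≥0) (k : ℤ) : walkPMF s k = ENNReal.ofReal (walkKernel s k) := rfl

theorem walkPMF_toMeasure_singleton (s : ℝ≥0) (k : ℤ) :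
    (walkPMF s).toMeasure {k} = ENNReal.ofReal (walkKernel s k) :=
  (walkPMF s).toMeasure_apply_singleton k trivial

theorem hasSum_indicator_walkPMF (s : ℝ≥0) (A : Set ℤ) :
    HasSum (A.indicator (walkKernel s)) ((walkPMF s).toMeasure.real A) := by
  have hsum : Summable (A.indicator (walkKernel s)) := (hasSum_walkKernel_one s.coe_nonneg).summable.indicator A
  have hnn (k : ℤ) : 0 ≤ A.indicator (walkKernel s) k :=
    Set.indicator_nonneg (fun k _ => walkKernel_nonneg s.coe_nonneg k) k
  have h : (walkPMF s).toMeasure A = ENNReal.ofReal (∑' k, A.indicator (walkKernel s) k) := by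
    rw [PMF.toMeasure_apply _ MeasurableSet.of_discrete, ENNReal.ofReal_tsum_of_nonneg hnn hsum]
    refine tsum_congr fun k => ?_
    by_cases hk : k ∈ A
    · rw [Set.indicator_of_mem hk, Set.indicator_of_mem hk, walkPMF_apply]
    · rw [Set.indicator_of_notMem hk, Set.indicator_of_notMem hk, ENNReal.ofReal_zero]
  rw [measureReal_def, h, ENNReal.toReal_ofReal (tsum_nonneg hnn)]
  exact hsum.hasSum

theorem memLp_log_walkKernel {s : ℝ≥0} (hs : 0 < s) :
    MemLp (fun k => Real.log (walkKernel s k)) 2 (walkPMF s).toMeasure := by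
  have hs' : (0 : ℝ) < s := hs
  have hsum : Summable fun k : ℤ => Real.log (walkKernel s k) ^ 2 * walkKernel s k := by
    refine summable_mul_walkKernel s.coe_nonneg 4 ((2 * s + 1 / s) ^ 2) fun k => ?_
    have h0 : Real.log (walkKernel s k) ≤ 0 :=
      Real.log_nonpos (walkKernel_nonneg s.coe_nonneg k) (walkKernel_le_one s.coe_nonneg k)
    have h1 := neg_log_walkKernel_le hs' k
    have h2 : 2 * (s : ℝ) + (k : ℝ) ^ 2 / s ≤ (2 * s + 1 / s) * (1 + |(k : ℝ)|) ^ 2 := by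
      have h3 : (k : ℝ) ^ 2 ≤ (1 + |(k : ℝ)|) ^ 2 := by
        rw [← sq_abs (k : ℝ)]
        exact pow_le_pow_left₀ (abs_nonneg _) (by linarith) 2
      have h4 : (1 : ℝ) ≤ (1 + |(k : ℝ)|) ^ 2 := one_le_pow₀ (by linarith [abs_nonneg (k : ℝ)])
      rw [add_mul, one_div, div_eq_inv_mul]
      have h5 := mul_le_mul_of_nonneg_left h4 (by positivity : 0 ≤ 2 * (s : ℝ))
      have h6 := mul_le_mul_of_nonneg_left h3 (inv_nonneg.2 hs'.le)
      linarith
    rw [abs_of_nonneg (sq_nonneg _), show 4 = 2 * 2 from rfl, pow_mul, ← mul_pow, ← neg_sq]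
    exact pow_le_pow_left₀ (by linarith) (h1.trans h2) 2
  rw [memLp_two_iff_integrable_sq measurable_from_top.aestronglyMeasurable]
  refine ⟨measurable_from_top.aestronglyMeasurable, ?_⟩
  rw [hasFiniteIntegral_iff_ofReal (Filter.Eventually.of_forall fun ω => sq_nonneg _),
    lintegral_countable']
  simp only [walkPMF_toMeasure_singleton, ← ENNReal.ofReal_mul (sq_nonneg _)]
  rw [← ENNReal.ofReal_tsum_of_nonneg (fun k => mul_nonneg (sq_nonneg _) (walkKernel_nonneg s.coe_nonneg k))
    hsum]
  exact ENNReal.ofReal_lt_top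

end WalkPMF

/-! ### Lower bounds on Var log p in dimension one. -/

section VarianceLowerBound

/-- A variable which takes values at least `α` and at most `β` with probability at least `ρ` each
has variance at least `ρ (α - β) ^ 2 / 4`. -/
theorem mul_sq_sub_le_variance {Ω : Type*} [MeasurableSpace Ω] {P : Measure Ω}
    [IsProbabilityMeasure P] {Y : Ω → ℝ} (hY : MemLp Y 2 P) {A B : Set Ω} (hA : MeasurableSet A)
    (hB : MeasurableSet B) {α β ρ : ℝ} (hρA : ρ ≤ P.real A) (hρB : ρ ≤ P.real B)
    (hYA : ∀ ω ∈ A, α ≤ Y ω) (hYB : ∀ ω ∈ B, Y ω ≤ β) (hαβ : β ≤ α) :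
    ρ * (α - β) ^ 2 / 4 ≤ variance Y P := by
  rw [variance_eq_integral hY.aestronglyMeasurable.aemeasurable]
  set m := ∫ ω, Y ω ∂P
  have hint : Integrable (fun ω => (Y ω - m) ^ 2) P := (hY.sub (memLp_const m)).integrable_sq
  have key (E : Set Ω) (hE : MeasurableSet E) (hρ : ρ ≤ P.real E)
      (h : ∀ ω ∈ E, ((α - β) / 2) ^ 2 ≤ (Y ω - m) ^ 2) :
      ρ * (α - β) ^ 2 / 4 ≤ ∫ ω, (Y ω - m) ^ 2 ∂P := by
    calc ρ * (α - β) ^ 2 / 4 ≤ P.real E • ((α - β) / 2) ^ 2 := by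
          rw [smul_eq_mul]
          nlinarith [mul_le_mul_of_nonneg_right hρ (sq_nonneg (α - β))]
      _ = ∫ ω, E.indicator (fun _ => ((α - β) / 2) ^ 2) ω ∂P :=
          (integral_indicator_const _ hE).symm
      _ ≤ _ := by
          refine integral_mono ((integrable_const _).indicator hE) hint fun ω => ?_
          by_cases hω : ω ∈ E
          · rw [Set.indicator_of_mem hω]
            exact h ω hω
          · rw [Set.indicator_of_notMem hω]
            exact sq_nonneg _
  rcases le_total m ((α + β) / 2) with h | h
  · refine key A hA hρA fun ω hω => pow_le_pow_left₀ (by linarith) ?_ 2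
    linarith [hYA ω hω]
  · refine key B hB hρB fun ω hω => ?_
    rw [← neg_sq (Y ω - m)]
    refine pow_le_pow_left₀ (by linarith) ?_ 2
    linarith [hYB ω hω]

theorem mul_sq_log_div_le_variance {s : ℝ≥0} (hs : 0 < s) {A B : Set ℤ} {a b ρ x : ℝ}
    (hb : 0 < b) (hx : 0 ≤ x) (hab : (1 + x) * b ≤ a) (hρ : 0 ≤ ρ)
    (hρA : ρ ≤ (walkPMF s).toMeasure.real A) (hρB : ρ ≤ (walkPMF s).toMeasure.real B)
    (hA : ∀ k ∈ A, a ≤ walkKernel s k) (hB : ∀ k ∈ B, walkKernel s k ≤ b) :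
    ρ * Real.log (1 + x) ^ 2 / 4 ≤
      variance (fun k => Real.log (walkKernel s k)) (walkPMF s).toMeasure := by
  have ha : 0 < a := lt_of_lt_of_le (by positivity) hab
  have hlog : Real.log (1 + x) ≤ Real.log a - Real.log b := by
    rw [← Real.log_div ha.ne' hb.ne']
    refine Real.log_le_log (by positivity) ?_
    rwa [le_div_iff₀ hb]
  have h0 : 0 ≤ Real.log (1 + x) := Real.log_nonneg (by linarith)
  refine le_trans ?_ (mul_sq_sub_le_variance (memLp_log_walkKernel hs) (A := A) (B := B)
    trivial trivial (α := Real.log a) (β := Real.log b) hρA hρB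
    (fun k hk => Real.log_le_log ha (hA k hk))
    (fun k hk => Real.log_le_log (walkKernel_pos hs k) (hB k hk)) (by linarith))
  have := pow_le_pow_left₀ h0 hlog 2
  gcongr

theorem real_walkPMF_singleton (s : ℝ≥0) (k : ℤ) :
    (walkPMF s).toMeasure.real {k} = walkKernel s k := by
  rw [measureReal_def, walkPMF_toMeasure_singleton, ENNReal.toReal_ofReal (walkKernel_nonneg s.coe_nonneg k)]

theorem varentBound_le_one {s : ℝ} (hs : 0 < s) : varentBound s ≤ 1 := by
  have h0 : 0 < √s := Real.sqrt_pos.2 hs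
  have h : Real.log (1 + 1 / √s) ≤ 1 / √s := by
    have := Real.log_le_sub_one_of_pos (x := 1 + 1 / √s) (by positivity)
    linarith
  have h' : 0 ≤ Real.log (1 + 1 / √s) := Real.log_nonneg (by
    have : 0 < 1 / √s := by positivity
    linarith)
  have h2 := pow_le_pow_left₀ h' h 2
  rw [div_pow, Real.sq_sqrt hs.le, one_pow] at h2
  rw [varentBound]
  calc s * Real.log (1 + 1 / √s) ^ 2 ≤ s * (1 / s) := by gcongr
    _ = 1 := by field_simp

theorem variance_log_walkKernel_small {s : ℝ≥0} (hs : 0 < s) (hs2 : (s : ℝ) ≤ 1 / 2) :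
    1 / 80 * varentBound s ≤
      variance (fun k => Real.log (walkKernel s k)) (walkPMF s).toMeasure := by
  have hs' : (0 : ℝ) < s := hs
  have he : Real.exp (-(2 * s)) ≥ 3 / 10 := by
    have h1 : Real.exp (-1) ≤ Real.exp (-(2 * s)) := Real.exp_le_exp.2 (by linarith)
    have := Real.exp_neg_one_gt_d9
    linarith
  have hp0 := exp_le_walkKernel_zero s.coe_nonneg
  have hp0' := walkKernel_le_one s.coe_nonneg 0
  have hp1 := mul_walkKernel_le_succ s.coe_nonneg 0
  have hp1' := walkKernel_step s.coe_nonneg 0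
  have hp2 := walkKernel_pos hs' 2
  have hp1pos := walkKernel_pos hs' 1
  norm_num at hp1 hp1'
  -- p(1) ≥ s p(0)/(s + 1), with p(0) ≥ 3/10 and s + 1 ≤ 3/2.
  have h1 : (s : ℝ) / 5 ≤ walkKernel s 1 := by nlinarith
  have h2 : walkKernel s 1 ≤ s * walkKernel s 0 := by nlinarith
  have h := mul_sq_log_div_le_variance hs (A := {0}) (B := {1}) (a := walkKernel s 0)
    (b := walkKernel s 1) (ρ := s / 5) (x := 1 / s - 1) hp1pos ?_ ?_ (by positivity) ?_ ?_ ?_ ?_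
  · refine le_trans ?_ h
    rw [add_sub_cancel]
    have hy : 1 ≤ √(1 / s : ℝ) := by
      rw [Real.one_le_sqrt, le_div_iff₀ hs']
      linarith
    set y := √(1 / s : ℝ) with hydef
    have hy2 : y ^ 2 = 1 / s := Real.sq_sqrt (by positivity)
    have hy3 : 1 / √(s : ℝ) = y := by rw [hydef, Real.sqrt_div zero_le_one, Real.sqrt_one]
    have hy4 : 2 ≤ y ^ 2 := by
      rw [hy2, le_div_iff₀ hs']
      linarith
    rw [varentBound, hy3, ← hy2]
    -- Since y² ≥ 2, 1 + y ≤ y⁴; this compares log(1 + 1/√s) with log(1/s).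
    have hl : Real.log (1 + y) ≤ 2 * Real.log (y ^ 2) := by
      have : Real.log (1 + y) ≤ Real.log ((y ^ 2) ^ 2) := by
        refine Real.log_le_log (by linarith) ?_
        nlinarith
      rwa [Real.log_pow, Nat.cast_ofNat] at this
    have hl0 : 0 ≤ Real.log (1 + y) := Real.log_nonneg (by linarith)
    have := pow_le_pow_left₀ hl0 hl 2
    nlinarith
  · rw [sub_nonneg, le_div_iff₀ hs']
    linarith
  · rw [add_sub_cancel, one_div_mul_eq_div, div_le_iff₀ hs']
    linarith
  · rw [real_walkPMF_singleton]
    linarith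
  · rwa [real_walkPMF_singleton]
  · rintro k rfl
    exact le_rfl
  · rintro k rfl
    exact le_rfl

theorem log_one_add_inv_ge (n : ℝ) (hn : 0 < n) : 1 / (n + 1) ≤ Real.log (1 + 1 / n) := by
  have h := Real.one_sub_inv_le_log_of_pos (x := 1 + 1 / n) (by positivity)
  refine le_trans (le_of_eq ?_) h
  field_simp
  ring

theorem variance_log_walkKernel_medium {s : ℝ≥0} (hs1 : 1 / 2 ≤ (s : ℝ)) (hs2 : (s : ℝ) ≤ 4) :
    Real.exp (-8) / 1500 ≤
      variance (fun k => Real.log (walkKernel s k)) (walkPMF s).toMeasure := by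
  have hs' : (0 : ℝ) < s := by linarith
  have he : Real.exp (-8) ≤ Real.exp (-(2 * s)) := Real.exp_le_exp.2 (by linarith)
  have hp0 := exp_le_walkKernel_zero s.coe_nonneg
  have hp1 := mul_walkKernel_le_succ s.coe_nonneg 0
  have hp2 := mul_walkKernel_le_succ s.coe_nonneg 1
  have hstep := walkKernel_two_step hs' 0
  have h2pos := walkKernel_pos hs' 2
  have h1pos := walkKernel_pos hs' 1
  have hepos := Real.exp_pos (-8)
  norm_num at hp1 hp2 hstep
  have e1 : Real.exp (-8) / 3 ≤ walkKernel s 1 := by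
    by_contra! hcon
    nlinarith
  have e2 : Real.exp (-8) / 15 ≤ walkKernel s 2 := by
    by_contra! hcon
    nlinarith
  have hinv : (1 : ℝ) / 4 ≤ (s : ℝ)⁻¹ := by
    rw [one_div]
    exact inv_anti₀ hs' hs2
  have h := mul_sq_log_div_le_variance (s := s) hs' (A := {0}) (B := {2}) (a := walkKernel s 0)
    (b := walkKernel s 2) (ρ := Real.exp (-8) / 15) (x := 1 / 4) h2pos (by norm_num) ?_
    (by positivity) ?_ ?_ ?_ ?_
  · refine le_trans ?_ h
    have hl := pow_le_pow_left₀ (by norm_num) (log_one_add_inv_ge 4 (by norm_num)) 2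
    nlinarith
  · nlinarith
  · rw [real_walkPMF_singleton]
    linarith
  · rwa [real_walkPMF_singleton]
  · rintro k rfl
    exact le_rfl
  · rintro k rfl
    exact le_rfl

/-- A second-moment argument: integrate k² ≤ s + k⁴/(32s) + 8s·1{k² ≥ s}, using E k² = 2s and E k⁴ =
12s² + 2s. -/
theorem real_walkPMF_tail_ge {s : ℝ≥0} (hs : 1 / 2 ≤ (s : ℝ)) :
    1 / 16 ≤ (walkPMF s).toMeasure.real {k : ℤ | (s : ℝ) ≤ (k : ℝ) ^ 2} := by
  have hs' : (0 : ℝ) < s := by linarith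
  have h1 := hasSum_sq_mul_walkKernel s.coe_nonneg
  have h2 := (((hasSum_walkKernel_one s.coe_nonneg).mul_left (s : ℝ)).add
    ((hasSum_pow_four_mul_walkKernel s.coe_nonneg).mul_left (1 / (32 * s : ℝ)))).add
    ((hasSum_indicator_walkPMF s {k : ℤ | (s : ℝ) ≤ (k : ℝ) ^ 2}).mul_left (8 * s : ℝ))
  have h := hasSum_le (fun k => ?_) h1 h2
  · set p := (walkPMF s).toMeasure.real {k : ℤ | (s : ℝ) ≤ (k : ℝ) ^ 2}
    have e : 1 / (32 * s : ℝ) * (12 * (s : ℝ) ^ 2 + 2 * s) = 3 / 8 * s + 1 / 16 := by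
      field_simp
      ring
    rw [e] at h
    by_contra! hcon
    nlinarith
  · have hp := walkKernel_nonneg s.coe_nonneg k
    have hpos : 0 ≤ 1 / (32 * s : ℝ) * ((k : ℝ) ^ 4 * walkKernel s k) := by positivity
    by_cases hk : k ∈ {k : ℤ | (s : ℝ) ≤ (k : ℝ) ^ 2}
    · rw [Set.indicator_of_mem hk]
      have : (k : ℝ) ^ 2 ≤ s + 1 / (32 * s : ℝ) * (k : ℝ) ^ 4 + 8 * s := by
        have h3 : 1 / (32 * s : ℝ) * (k : ℝ) ^ 4 = ((k : ℝ) ^ 2) ^ 2 / (32 * s) := by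
          rw [← pow_mul]
          ring
        have h4 : (k : ℝ) ^ 2 - 8 * s ≤ ((k : ℝ) ^ 2) ^ 2 / (32 * s) := by
          rw [le_div_iff₀ (by positivity)]
          nlinarith [sq_nonneg ((k : ℝ) ^ 2 - 16 * s)]
        linarith
      nlinarith [mul_le_mul_of_nonneg_right this hp]
    · rw [Set.indicator_of_notMem hk]
      have hk' : (k : ℝ) ^ 2 ≤ s := le_of_lt (not_le.1 hk)
      nlinarith [mul_le_mul_of_nonneg_right hk' hp]

theorem sum_range_mul_le_of_antitone {f : ℕ → ℝ} (hf : Antitone f) (m n : ℕ) :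
    ∑ i ∈ Finset.range (m * n), f i ≤ m * ∑ i ∈ Finset.range n, f i := by
  induction m with
  | zero => simp
  | succ m ih =>
    rw [add_mul, one_mul, Finset.sum_range_add]
    have : ∑ x ∈ Finset.range n, f (m * n + x) ≤ ∑ x ∈ Finset.range n, f x :=
      Finset.sum_le_sum fun x _ => hf (Nat.le_add_left x _)
    push_cast
    linarith

/-- Chebyshev puts mass 1/2 on |k| < 12n. By monotonicity the first of the 12 blocks of length n
carries at least 1/12 of the mass of the half-line part; counting 0 twice when folding costs a
factor 2. -/
theorem real_walkPMF_center_ge {s : ℝ≥0} (hs : 0 < s) {n : ℕ} (hn : √(s : ℝ) ≤ 6 * n) :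
    1 / 48 ≤ (walkPMF s).toMeasure.real {k : ℤ | k.natAbs < n} := by
  have hs' : (0 : ℝ) < s := hs
  set N := 12 * n with hN
  have hcheb : 1 / 2 ≤ (walkPMF s).toMeasure.real {k : ℤ | k.natAbs < N} := by
    have h := hasSum_le (fun k => ?_) (hasSum_walkKernel_one s.coe_nonneg)
      (((hasSum_sq_mul_walkKernel s.coe_nonneg).mul_left (1 / (4 * s : ℝ))).add
        (hasSum_indicator_walkPMF s {k : ℤ | k.natAbs < N}))
    · have e : 1 / (4 * s : ℝ) * (2 * s) = 1 / 2 := by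
        field_simp
        norm_num
      rw [e] at h
      linarith
    · have hp := walkKernel_nonneg s.coe_nonneg k
      by_cases hk : k ∈ {k : ℤ | k.natAbs < N}
      · rw [Set.indicator_of_mem hk]
        have : 0 ≤ 1 / (4 * s : ℝ) * ((k : ℝ) ^ 2 * walkKernel s k) := by positivity
        linarith
      · rw [Set.indicator_of_notMem hk, add_zero, ← mul_assoc]
        refine le_mul_of_one_le_left hp ?_
        rw [one_div_mul_eq_div, one_le_div (by positivity)]
        have h1 : (N : ℝ) ≤ |(k : ℝ)| := by
          rw [← Int.cast_abs, Int.abs_eq_natAbs]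
          exact_mod_cast not_lt.1 hk
        have h2 : 2 * √(s : ℝ) ≤ |(k : ℝ)| := by
          refine le_trans ?_ h1
          rw [hN]
          push_cast
          linarith
        have h3 := pow_le_pow_left₀ (by positivity) h2 2
        rw [sq_abs, mul_pow, Real.sq_sqrt hs'.le] at h3
        linarith
  have hcenter : (walkPMF s).toMeasure.real {k : ℤ | k.natAbs < N} ≤
      2 * ∑ i ∈ Finset.range N, walkKernel s i := by
    have h := (hasSum_indicator_walkPMF s {k : ℤ | k.natAbs < N}).nat_add_neg
    have h' : HasSum (fun i : ℕ => 2 * Set.indicator {k : ℤ | k.natAbs < N} (walkKernel s) i)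
        (∑ i ∈ Finset.range N, 2 * walkKernel s i) := by
      have e : ∑ i ∈ Finset.range N, 2 * walkKernel s i = ∑ i ∈ Finset.range N,
          2 * Set.indicator {k : ℤ | k.natAbs < N} (walkKernel s) (i : ℤ) := by
        refine Finset.sum_congr rfl fun i hi => ?_
        rw [Set.indicator_of_mem]
        simpa using hi
      rw [e]
      refine hasSum_sum_of_ne_finset_zero fun i hi => ?_
      rw [Set.indicator_of_notMem, mul_zero]
      simpa using hi
    have e (i : ℕ) : Set.indicator {k : ℤ | k.natAbs < N} (walkKernel s) (i : ℤ) +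
        Set.indicator {k : ℤ | k.natAbs < N} (walkKernel s) (-(i : ℤ)) =
        2 * Set.indicator {k : ℤ | k.natAbs < N} (walkKernel s) i := by
      have : Set.indicator {k : ℤ | k.natAbs < N} (walkKernel s) (-(i : ℤ)) =
          Set.indicator {k : ℤ | k.natAbs < N} (walkKernel s) i := by
        simp [Set.indicator_apply, walkKernel_neg]
      rw [this, two_mul]
    simp only [e] at h
    have h0 : 0 ≤ Set.indicator {k : ℤ | k.natAbs < N} (walkKernel s) 0 :=
      Set.indicator_nonneg (fun k _ => walkKernel_nonneg s.coe_nonneg k) 0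
    have := h.unique h'
    rw [Finset.mul_sum]
    linarith
  have hblock := sum_range_mul_le_of_antitone (f := fun i : ℕ => walkKernel s i)
    (fun i j hij => walkKernel_antitone s.coe_nonneg hij) 12 n
  have hlow : ∑ i ∈ Finset.range n, walkKernel s i ≤
      (walkPMF s).toMeasure.real {k : ℤ | k.natAbs < n} := by
    have h := sum_le_hasSum ((Finset.range n).map Nat.castEmbedding)
      (fun k _ => Set.indicator_nonneg (fun k _ => walkKernel_nonneg s.coe_nonneg k) k)
      (hasSum_indicator_walkPMF s {k : ℤ | k.natAbs < n})
    refine le_trans (le_of_eq ?_) h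
    rw [Finset.sum_map]
    refine Finset.sum_congr rfl fun i hi => ?_
    rw [Set.indicator_of_mem]
    · rfl
    · simpa using hi
  push_cast at hblock
  linarith

theorem variance_log_walkKernel_large {s : ℝ≥0} (hs : 4 ≤ (s : ℝ)) :
    1 / 300000 ≤ variance (fun k => Real.log (walkKernel s k)) (walkPMF s).toMeasure := by
  have hs' : (0 : ℝ) < s := by linarith
  have hsqrt : 2 ≤ √(s : ℝ) := Real.le_sqrt_of_sq_le (by linarith)
  have hsq := Real.sq_sqrt hs'.le
  -- The first condition puts the tail |k| ≥ √s beyond m + 2(m+1); the second gives the centre its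
  -- mass and the ratio (m+1)²/s ≥ 1/36.
  obtain ⟨m, hm1, hm2⟩ : ∃ m : ℕ, 3 * (m : ℝ) + 2 ≤ √(s : ℝ) ∧ √(s : ℝ) ≤ 6 * (m + 1 : ℕ) := by
    refine ⟨⌊(√(s : ℝ) - 2) / 3⌋₊, ?_, ?_⟩
    · have := Nat.floor_le (a := (√(s : ℝ) - 2) / 3) (by linarith)
      linarith
    · have h1 := Nat.lt_floor_add_one ((√(s : ℝ) - 2) / 3)
      have h2 := Nat.cast_nonneg (α := ℝ) ⌊(√(s : ℝ) - 2) / 3⌋₊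
      push_cast
      linarith
  have hsteps := walkKernel_many_steps hs' m (m + 1)
  have hx : (1 : ℝ) / 36 ≤ (m + 1 : ℕ) * ((m + 1) / s) := by
    push_cast at hm2 ⊢
    rw [mul_div_assoc', le_div_iff₀ hs']
    nlinarith
  have hpos := walkKernel_pos hs' (m + 2 * (m + 1) : ℕ)
  have h := mul_sq_log_div_le_variance (s := s) hs' (A := {k : ℤ | k.natAbs < m + 1})
    (B := {k : ℤ | (s : ℝ) ≤ (k : ℝ) ^ 2}) (a := walkKernel s m)
    (b := walkKernel s (m + 2 * (m + 1) : ℕ)) (ρ := 1 / 48) (x := 1 / 36) hpos (by norm_num) ?_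
    (by norm_num) (real_walkPMF_center_ge hs' hm2)
    (le_trans (by norm_num) (real_walkPMF_tail_ge (by linarith))) ?_ ?_
  · refine le_trans ?_ h
    have hl := pow_le_pow_left₀ (by norm_num) (log_one_add_inv_ge 36 (by norm_num)) 2
    norm_num at hl ⊢
    linarith
  · refine le_trans ?_ hsteps
    exact mul_le_mul_of_nonneg_right (by linarith) hpos.le
  · intro k hk
    rw [← walkKernel_natAbs s k]
    exact walkKernel_antitone hs'.le (Nat.lt_succ_iff.1 hk)
  · intro k hk
    rw [← walkKernel_natAbs s k]
    refine walkKernel_antitone hs'.le ?_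
    have h1 : √(s : ℝ) ≤ |(k : ℝ)| := Real.sqrt_le_sqrt hk |>.trans_eq (Real.sqrt_sq_eq_abs _)
    have h2 : ((m + 2 * (m + 1) : ℕ) : ℝ) ≤ (k.natAbs : ℕ) := by
      rw [Nat.cast_natAbs, Int.cast_abs]
      push_cast
      linarith
    exact_mod_cast h2

theorem varentBound_le_variance_log_walkKernel {s : ℝ≥0} (hs : 0 < s) :
    Real.exp (-8) / 300000 * varentBound s ≤
      variance (fun k => Real.log (walkKernel s k)) (walkPMF s).toMeasure := by
  have hs' : (0 : ℝ) < s := hs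
  have he : Real.exp (-8) ≤ 1 := Real.exp_le_one_iff.2 (by norm_num)
  have he0 := Real.exp_pos (-8)
  have hV0 := varentBound_nonneg hs'.le
  -- For s ≥ 1/2 a constant lower bound on the variance suffices, because V ≤ 1.
  have hV1 := varentBound_le_one hs'
  rcases le_total (s : ℝ) (1 / 2) with h1 | h1
  · refine le_trans ?_ (variance_log_walkKernel_small hs h1)
    exact mul_le_mul_of_nonneg_right (by linarith) hV0
  · rcases le_total (s : ℝ) 4 with h2 | h2
    · refine le_trans ?_ (variance_log_walkKernel_medium h1 h2)
      nlinarith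
    · refine le_trans ?_ (variance_log_walkKernel_large h2)
      nlinarith

end VarianceLowerBound

/-! ### Additivity over coordinates and the lower bound on ℤ^d. -/

section LowerBound

variable {d : ℕ} {Ω : Type*} [MeasurableSpace Ω] {P : Measure Ω} [IsProbabilityMeasure P]

theorem HasWalkLaw.measurePreserving_pi {rate : Fin d → ℝ≥0} {t : ℝ≥0}
    {Y : Ω → Multiplicative (Fin d → ℤ)}
    (hY : HasWalkLaw (generatorMeasure unitVector rate) t P Y) :
    MeasurePreserving (fun ω => (Y ω).toAdd) P
      (Measure.pi fun i => (walkPMF (rate i * t)).toMeasure) := by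
  have hm : Measurable fun ω => (Y ω).toAdd := hY.measurable_comp Multiplicative.toAdd
  refine ⟨hm, Measure.ext_of_singleton fun x => ?_⟩
  rw [Measure.pi_singleton, Measure.map_apply hm (measurableSet_singleton x)]
  have h : (fun ω => (Y ω).toAdd) ⁻¹' {x} = Y ⁻¹' {Multiplicative.ofAdd x} := rfl
  rw [h, ← ofReal_measureReal, hY.real_preimage_singleton,
    heatKernel_generatorMeasure_unitVector,
    ENNReal.ofReal_prod_of_nonneg fun i _ => walkKernel_nonneg (by positivity) _]
  refine Finset.prod_congr rfl fun i _ => ?_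
  rw [walkPMF_toMeasure_singleton, NNReal.coe_mul]

theorem HasWalkLaw.le_varent {rate : Fin d → ℝ≥0} (hrate : ∀ i, 0 < rate i) {t : ℝ≥0}
    {Y : Ω → Multiplicative (Fin d → ℤ)}
    (hY : HasWalkLaw (generatorMeasure unitVector rate) t P Y) :
    ENNReal.ofReal (Real.exp (-8) / 300000 * ∑ i, varentBound (rate i * t)) ≤ varent P Y := by
  -- At t = 0 the kernel is not positive, so its logarithm is not additive; there the bound is
  -- trivial because V(0) = 0.
  rcases eq_zero_or_pos t with rfl | ht
  · simp [varentBound]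
  have hs (i : Fin d) : 0 < rate i * t := mul_pos (hrate i) ht
  let f : Fin d → ℤ → ℝ := fun i k => Real.log (walkKernel (rate i * t : ℝ≥0) k)
  have hf (i : Fin d) : MemLp (f i) 2 (walkPMF (rate i * t)).toMeasure :=
    memLp_log_walkKernel (hs i)
  have hpi := hY.measurePreserving_pi
  have hF : MemLp (∑ i, fun x : Fin d → ℤ => f i (x i)) 2
      (Measure.pi fun i => (walkPMF (rate i * t)).toMeasure) :=
    memLp_finsetSum' _ fun i _ => (hf i).comp_measurePreserving (measurePreserving_eval _ i)
  have hv : varent P Y =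
      evariance ((∑ i, fun x : Fin d → ℤ => f i (x i)) ∘ fun ω => (Y ω).toAdd) P := by
    rw [varent]
    congr 1
    ext ω
    rw [hY.real_preimage_singleton, ← ofAdd_toAdd (Y ω), heatKernel_generatorMeasure_unitVector,
      Real.log_prod fun i _ => (walkKernel_pos (by exact_mod_cast hs i) _).ne']
    simp [f]
  rw [hv, ← ofReal_variance (hF.comp_measurePreserving hpi)]
  refine ENNReal.ofReal_le_ofReal ?_
  have hvar := hpi.variance_fun_comp (f := ∑ i, fun x : Fin d → ℤ => f i (x i))
    hF.aestronglyMeasurable.aemeasurable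
  rw [Function.comp_def, hvar, variance_sum_pi hf, Finset.mul_sum]
  refine Finset.sum_le_sum fun i _ => ?_
  have h := varentBound_le_variance_log_walkKernel (hs i)
  rwa [NNReal.coe_mul] at h

end LowerBound

end

theorem theorem1 :
    (∃ c : ℝ, 0 < c ∧
      ∀ (G : Type*) [Group G] [TopologicalSpace G] [DiscreteTopology G] (μ : G →₀ ℝ≥0),
        (∀ x z : G, μ (x * z * x⁻¹) = μ z) →
        (∀ z : G, μ z⁻¹ = μ z) →
        -- the value of `μ` at the identity does not affect the walk
        ∀ (d : ℕ) (e : Fin d → G) (rate : Fin d → ℝ≥0),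
          (∀ i, 0 < rate i) → μ.erase 1 = generatorMeasure e rate →
        ∀ (Ω : Type*) [MeasurableSpace Ω] (P : Measure Ω) [IsProbabilityMeasure P]
          (X : ℝ≥0 → Ω → G), IsRandomWalk μ P X →
        ∀ t : ℝ≥0, varent P (X t) ≤ ENNReal.ofReal (c * ∑ i, varentBound (rate i * t))) ∧
    (∃ c : ℝ, 0 < c ∧
      ∀ (d : ℕ) (rate : Fin d → ℝ≥0), (∀ i, 0 < rate i) →
        ∀ (Ω : Type*) [MeasurableSpace Ω] (P : Measure Ω) [IsProbabilityMeasure P]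
          (X : ℝ≥0 → Ω → Multiplicative (Fin d → ℤ)),
          IsRandomWalk (generatorMeasure unitVector rate) P X →
        ∀ t : ℝ≥0, ENNReal.ofReal (c * ∑ i, varentBound (rate i * t)) ≤ varent P (X t)) := by
  refine ⟨⟨32, by norm_num, ?_⟩, ⟨Real.exp (-8) / 300000, by positivity, ?_⟩⟩
  · intro G _ _ _ μ hμ hsymm d e rate hrate h Ω _ P _ X hX t
    exact (hX.hasWalkLaw t).varent_le hμ hsymm hrate h
  · intro d rate hrate Ω _ P _ X hX t
    exact (hX.hasWalkLaw t).le_varent hrate
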